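/- **Theorem 3 (Equivalence of the dEIRL Algorithm and Kleinman's Algorithm).** *System.* Consider $\dot x = f(x) + g(x)u$ on $\mathbb{R}^n$, $u\in\mathbb{R}^m$, with $f(0)=0$, with $f, g$ Lipschitz on a compact set containing $0$ in its interior and $f$ differentiable at $0$, with linearization $A = Df(0)$, $B = g(0)$. State and control are partitioned into $N$ loops, $x=(x_1,\dots,x_N)$, $u=(u_1,\dots,u_N)$, $x_k\in\mathbb{R}^{n_k}$, $u_k\in\mathbb{R}^{m_k}$; $f_j$ and $g_j$ denote the rows of $f$ and $g$ belonging to loop $j$ ($g_j(x)\in\mathbb{R}^{n_j\times m}$), and $A_{jj}$, $B_{jj}$ the diagonal blocks of $A$, $B$. Nothing is assumed on the coupling between the loops. Fix a loop $j$ and $Q_j=Q_j^T\ge 0$, $R_j=R_j^T>0$. *Operators.* Put $\underline{n}_j = n_j(n_j+1)/2$ and index the coordinates of $\mathbb{R}^{\underline{n}_j}$ by the pairs $p\le q$. For $P\in\mathbb{R}^{n_j\times n_j}$ let $v(P)$ have the entries $p_{pp}$ and $2p_{pq}$ ($p<q$); let $\mathcal{B}(y,z)$ have the entries $\tfrac12(y_pz_q+y_qz_p)$;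 let $W$ be the matrix with $\mathcal{B}(y,z)=W(y\otimes z)$ for all $y,z$, and $W_r^{-1}$ its right inverse with $y\otimes y = W_r^{-1}\mathcal{B}(y,y)$ for all $y$. *Data.* Apply $u_k=-K_{0,k}x_k+d_k$ in every loop $k$, with arbitrary gains $K_{0,k}$ and exploration noises $d_k$; let $t_0<\dots<t_l$, let $x$ be a (Carathéodory) solution on $[t_0,t_l]$, put $w_j = f_j(x)-A_{jj}x_j$, and suppose that $g_j(x)u$ and $w_j$ are square-integrable on $[t_0,t_l]$. For signals $y,z$ let $I_{\mathcal{B}(y,z)}\in\mathbb{R}^{l\times\underline{n}_j}$ have the rows $\int_{t_{k-1}}^{t_k}\mathcal{B}^T(y,z)\,d\tau$, and let $\delta_{x_jx_j}$ have the rows $\mathcal{B}^T\big(x_j(t_k)+x_j(t_{k-1}),\,x_j(t_k)-x_j(t_{k-1})\big)$, $k=1,\dots,l$. *Algorithms.* Both start from $K_{0,j}$ and update $K_{i+1,j}=R_j^{-1}B_{jj}^TP_{i,j}$, $i\ge 0$. Kleinman's algorithm for $(A_{jj},B_{jj},Q_j,R_j)$ takes for $P_{i,j}$ the symmetric positive semidefinite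 solution of $$(A_{jj}-B_{jj}K_{i,j})^TP_{i,j}+P_{i,j}(A_{jj}-B_{jj}K_{i,j})+K_{i,j}^TR_jK_{i,j}+Q_j=0 .$$ The dEIRL algorithm takes for $P_{i,j}$ the symmetric matrix for which $v(P_{i,j})$ is the least-squares solution of $\Theta_{i,j}v(P_{i,j})=\Xi_{i,j}$, where $$\Theta_{i,j}=\delta_{x_jx_j}-2\big[I_{\mathcal{B}(x_j,x_j)}W_{i,j}^T+I_{\mathcal{B}(x_j,g_ju)}+I_{\mathcal{B}(x_j,w_j)}\big],\quad W_{i,j}=W(I_{n_j}\otimes B_{jj}K_{i,j})W_r^{-1},$$ $$\Xi_{i,j}=-I_{\mathcal{B}(x_j,x_j)}\,v(Q_j+K_{i,j}^TR_jK_{i,j}).$$ *Claim.* Suppose that $I_{\mathcal{B}(x_j,x_j)}$ has full column rank $\underline{n}_j$ and that $A_{jj}-B_{jj}K_{0,j}$ is Hurwitz. Then each algorithm produces exactly one pair of sequences $\{P_{i,j}\}_{i\ge0}$, $\{K_{i,j}\}_{i\ge0}$, the two pairs are identical, and $\Theta_{i,j}v(P_{i,j})=\Xi_{i,j}$ holds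 exactly for all $i\ge 0$. Moreover $A_{jj}-B_{jj}K_{i,j}$ is Hurwitz and $P_{i+1,j}\le P_{i,j}$ for all $i\ge0$. If $(Q_j^{1/2},A_{jj})$ is detectable, then the Riccati equation $$A_{jj}^TP+PA_{jj}-PB_{jj}R_j^{-1}B_{jj}^TP+Q_j=0$$ has a unique positive semidefinite solution $P_j^*$, and with $K_j^*=R_j^{-1}B_{jj}^TP_j^*$ one has $P_j^*\le P_{i,j}$ for all $i\ge 0$, $\lim_{i\to\infty}K_{i,j}=K_j^*$ and $\lim_{i\to\infty}P_{i,j}=P_j^*$. If moreover $(Q_j^{1/2},A_{jj})$ is observable, then $P_j^*$ and all the $P_{i,j}$ are positive definite. -/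

import Mathlib

open scoped Matrix Topology

namespace DEIRL

noncomputable section

/-! ### Linear-quadratic notions -/

/-- A real square matrix is Hurwitz if all its complex eigenvalues have negative real part. -/
def IsHurwitz {n : ℕ} (M : Matrix (Fin n) (Fin n) ℝ) : Prop :=
  ∀ z ∈ spectrum ℂ (M.map (algebraMap ℝ ℂ)), z.re < 0

/-- The pair `(C, A)` is detectable. -/
def IsDetectable {n p : ℕ} (C : Matrix (Fin p) (Fin n) ℝ) (A : Matrix (Fin n) (Fin n) ℝ) :
    Prop :=
  ∃ L : Matrix (Fin n) (Fin p) ℝ, IsHurwitz (A - L * C)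

/-- The pair `(C, A)` is observable: the unobservable subspace is trivial. -/
def IsObservable {n p : ℕ} (C : Matrix (Fin p) (Fin n) ℝ) (A : Matrix (Fin n) (Fin n) ℝ) :
    Prop :=
  ∀ z : Fin n → ℝ, (∀ k : ℕ, C *ᵥ (A ^ k *ᵥ z) = 0) → z = 0

/-- `S` is the positive semidefinite square root `Q^{1/2}`. -/
def IsPSDSqrt {n : ℕ} (Q S : Matrix (Fin n) (Fin n) ℝ) : Prop :=
  S.PosSemidef ∧ S * S = Q

/-- `P` is a solution of the control algebraic Riccati equation of `(A, B, Q, R)`. -/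
def SolvesCARE {n m : ℕ} (A : Matrix (Fin n) (Fin n) ℝ) (B : Matrix (Fin n) (Fin m) ℝ)
    (Q : Matrix (Fin n) (Fin n) ℝ) (R : Matrix (Fin m) (Fin m) ℝ)
    (P : Matrix (Fin n) (Fin n) ℝ) : Prop :=
  Aᵀ * P + P * A - P * B * R⁻¹ * Bᵀ * P + Q = 0

/-- `P` is a solution of the algebraic Lyapunov equation for the controller `K`. -/
def SolvesALE {n m : ℕ} (A : Matrix (Fin n) (Fin n) ℝ) (B : Matrix (Fin n) (Fin m) ℝ)
    (Q : Matrix (Fin n) (Fin n) ℝ) (R : Matrix (Fin m) (Fin m) ℝ)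
    (K : Matrix (Fin m) (Fin n) ℝ) (P : Matrix (Fin n) (Fin n) ℝ) : Prop :=
  (A - B * K)ᵀ * P + P * (A - B * K) + Kᵀ * R * K + Q = 0

/-- `(P, K)` are sequences produced by Kleinman's algorithm for `(A, B, Q, R)` started at `K₀`. -/
def IsKleinmanSeq {n m : ℕ} (A : Matrix (Fin n) (Fin n) ℝ) (B : Matrix (Fin n) (Fin m) ℝ)
    (Q : Matrix (Fin n) (Fin n) ℝ) (R : Matrix (Fin m) (Fin m) ℝ)
    (K₀ : Matrix (Fin m) (Fin n) ℝ)
    (P : ℕ → Matrix (Fin n) (Fin n) ℝ) (K : ℕ → Matrix (Fin m) (Fin n) ℝ) : Prop :=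
  K 0 = K₀ ∧ ∀ i : ℕ,
    ((P i).PosSemidef ∧ SolvesALE A B Q R (K i) (P i)) ∧ K (i + 1) = R⁻¹ * Bᵀ * P i

/-! ### The operators `v`, `𝓑`, `W`, `W_r⁻¹`

The `n (n + 1) / 2` coordinates are labelled by the pairs `(p, q)` with `p ≤ q`. -/

/-- Positions on or above the diagonal. -/
abbrev UpperIdx (n : ℕ) : Type := {p : Fin n × Fin n // p.1 ≤ p.2}

theorem card_upperIdx (n : ℕ) : Fintype.card (UpperIdx n) = n * (n + 1) / 2 := by
  classical
  have h : Fintype.card (UpperIdx n) = ∑ b : Fin n, ((b : ℕ) + 1) := by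
    rw [Fintype.card_subtype, Finset.card_filter, Fintype.sum_prod_type_right]
    refine Finset.sum_congr rfl fun b _ => ?_
    rw [← Finset.card_filter]
    have : (Finset.univ.filter fun a : Fin n => a ≤ b) = Finset.Iic b := by ext; simp
    simp [this]
  rw [h, Fin.sum_univ_eq_sum_range (fun i => i + 1) n]
  have h2 := Finset.sum_range_succ' (fun i => i) n
  simp only [add_zero] at h2
  rw [← h2, Finset.sum_range_id, Nat.add_sub_cancel, Nat.mul_comm]

/-- `v(P) = [p₁₁, 2 p₁₂, …, 2 p₁ₙ, p₂₂, 2 p₂₃, …, pₙₙ]ᵀ`. -/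
def vec {n : ℕ} (P : Matrix (Fin n) (Fin n) ℝ) : UpperIdx n → ℝ := fun e =>
  if e.1.1 = e.1.2 then P e.1.1 e.1.2 else 2 * P e.1.1 e.1.2

/-- The symmetric bilinear map `𝓑(x, y)`, with entries `(x_p y_q + x_q y_p) / 2`, `p ≤ q`. -/
def bil {n : ℕ} (x y : Fin n → ℝ) : UpperIdx n → ℝ := fun e =>
  (x e.1.1 * y e.1.2 + x e.1.2 * y e.1.1) / 2

/-- The Kronecker product `x ⊗ y` of two vectors. -/
def kronVec {n : ℕ} (x y : Fin n → ℝ) : Fin n × Fin n → ℝ := fun p => x p.1 * y p.2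

/-- The matrix `W`, with `𝓑(x, y) = W (x ⊗ y)`. -/
def Wmat (n : ℕ) : Matrix (UpperIdx n) (Fin n × Fin n) ℝ := fun e p =>
  ((if p = e.1 then 1 else 0) + (if p = e.1.swap then 1 else 0)) / 2

/-- The right inverse `W_r⁻¹` of `W`, with `x ⊗ x = W_r⁻¹ 𝓑(x, x)`. -/
def WrInv (n : ℕ) : Matrix (Fin n × Fin n) (UpperIdx n) ℝ := fun p e =>
  if p = e.1 ∨ p = e.1.swap then 1 else 0

theorem Wmat_mulVec_kronVec {n : ℕ} (x y : Fin n → ℝ) :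
    Wmat n *ᵥ kronVec x y = bil x y := by
  funext e
  simp [Matrix.mulVec, dotProduct, Wmat, kronVec, bil, add_div, add_mul, Finset.sum_add_distrib,
    ite_div, ite_mul]
  ring

theorem WrInv_mulVec_bil {n : ℕ} (x : Fin n → ℝ) :
    WrInv n *ᵥ bil x x = kronVec x x := by
  funext p
  obtain ⟨a, b⟩ := p
  simp only [Matrix.mulVec, dotProduct, WrInv, ite_mul, one_mul, zero_mul]
  rcases le_total a b with hab | hab
  · rw [Finset.sum_eq_single (⟨(a, b), hab⟩ : UpperIdx n)]
    · simp [bil, kronVec]; ring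
    · rintro ⟨⟨c, d⟩, hcd⟩ - hne
      rw [if_neg]
      rintro (h | h) <;> simp only [Prod.swap, Prod.mk.injEq] at h <;> apply hne <;>
        simp only [Subtype.mk.injEq, Prod.mk.injEq]
      · exact ⟨h.1.symm, h.2.symm⟩
      · simp only at hcd
        constructor <;> omega
    · simp
  · rw [Finset.sum_eq_single (⟨(b, a), hab⟩ : UpperIdx n)]
    · simp [bil, kronVec]; ring
    · rintro ⟨⟨c, d⟩, hcd⟩ - hne
      rw [if_neg]
      rintro (h | h) <;> simp only [Prod.swap, Prod.mk.injEq] at h <;> apply hne <;>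
        simp only [Subtype.mk.injEq, Prod.mk.injEq]
      · simp only at hcd
        constructor <;> omega
      · exact ⟨h.2.symm, h.1.symm⟩
    · simp

theorem Wmat_mul_WrInv (n : ℕ) : Wmat n * WrInv n = 1 := by
  ext ⟨⟨a, b⟩, hab⟩ ⟨⟨c, d⟩, hcd⟩
  simp only at hab hcd
  simp only [Matrix.mul_apply, Wmat, WrInv, add_div, add_mul, Finset.sum_add_distrib, ite_div,
    zero_div, ite_mul, zero_mul, Finset.sum_ite_eq', Finset.mem_univ, if_true,
    Prod.swap, Prod.mk.injEq, Matrix.one_apply, Subtype.mk.injEq]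
  by_cases h : a = c ∧ b = d
  · obtain ⟨rfl, rfl⟩ := h
    norm_num
  · have h1 : ¬ (a = d ∧ b = c) := by
      rintro ⟨rfl, rfl⟩
      exact h ⟨le_antisymm hab hcd, le_antisymm hcd hab⟩
    have h2 : ¬ (b = c ∧ a = d) := fun h' => h1 ⟨h'.2, h'.1⟩
    have h3 : ¬ (b = d ∧ a = c) := fun h' => h ⟨h'.2, h'.1⟩
    simp [h, h1, h2, h3]

/-- Full column rank. -/
def FullColumnRank {r c : Type*} [Fintype c] (M : Matrix r c ℝ) : Prop :=
  M.rank = Fintype.card c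

/-- The data matrix `δ_{xy}` for the sample instants `t 0 < ⋯ < t l`. -/
def deltaMat {n l : ℕ} (t : Fin (l + 1) → ℝ) (x y : ℝ → Fin n → ℝ) :
    Matrix (Fin l) (UpperIdx n) ℝ := fun k =>
  bil (x (t k.succ) + y (t k.castSucc)) (x (t k.succ) - y (t k.castSucc))

/-- The data matrix `I_{𝓑(x, y)}` for the sample instants `t 0 < ⋯ < t l`. -/
def intMat {n l : ℕ} (t : Fin (l + 1) → ℝ) (x y : ℝ → Fin n → ℝ) :
    Matrix (Fin l) (UpperIdx n) ℝ := fun k e =>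
  ∫ τ in (t k.castSucc)..(t k.succ), bil (x τ) (y τ) e

/-! ### Partitioned nonlinear systems -/

/-- Global index set of a vector partitioned into `N` blocks of lengths `n 0, …, n (N - 1)`. -/
abbrev BlockIdx {N : ℕ} (n : Fin N → ℕ) : Type := Σ k : Fin N, Fin (n k)

/-- The `j`-th block of a partitioned vector. -/
def block {N : ℕ} {n : Fin N → ℕ} (j : Fin N) (z : BlockIdx n → ℝ) : Fin (n j) → ℝ :=
  fun a => z ⟨j, a⟩

/-- A control-affine system `ẋ = f(x) + g(x) u`, with state and control partitioned into `N` loops,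
with `f`, `g` Lipschitz on a compact neighbourhood of the equilibrium `0`, and with `f` having
a linearization at `0`. No structure is imposed on the coupling between the loops. -/
structure PartitionedSystem {N : ℕ} (n m : Fin N → ℕ) where
  f : (BlockIdx n → ℝ) → (BlockIdx n → ℝ)
  g : (BlockIdx n → ℝ) → Matrix (BlockIdx n) (BlockIdx m) ℝ
  dom : Set (BlockIdx n → ℝ)
  isCompact_dom : IsCompact dom
  zero_mem_interior_dom : (0 : BlockIdx n → ℝ) ∈ interior dom
  lipschitz_f : ∃ C, LipschitzOnWith C f dom
  lipschitz_g : ∃ C, ∀ p q, LipschitzOnWith C (fun z => g z p q) dom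
  f_zero : f 0 = 0
  differentiableAt_f : DifferentiableAt ℝ f 0

namespace PartitionedSystem

variable {N : ℕ} {n m : Fin N → ℕ} (sys : PartitionedSystem n m)

/-- The drift matrix of the linearization at the origin. -/
def A : Matrix (BlockIdx n) (BlockIdx n) ℝ :=
  LinearMap.toMatrix' (fderiv ℝ sys.f 0 : (BlockIdx n → ℝ) →ₗ[ℝ] (BlockIdx n → ℝ))

/-- The input matrix of the linearization at the origin. -/
def B : Matrix (BlockIdx n) (BlockIdx m) ℝ := sys.g 0

/-- The diagonal block `A_{jj}`. -/
def Ajj (j : Fin N) : Matrix (Fin (n j)) (Fin (n j)) ℝ := Matrix.blockDiag' sys.A j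

/-- The diagonal block `B_{jj}`. -/
def Bjj (j : Fin N) : Matrix (Fin (n j)) (Fin (m j)) ℝ := Matrix.blockDiag' sys.B j

end PartitionedSystem

/-- The control `u_k = - K_{0,k} x_k + d_k` in every loop `k`. -/
def control {N : ℕ} {n m : Fin N → ℕ} (K₀ : ∀ k, Matrix (Fin (m k)) (Fin (n k)) ℝ)
    (d : ℝ → BlockIdx m → ℝ) (x : ℝ → BlockIdx n → ℝ) (τ : ℝ) : BlockIdx m → ℝ :=
  fun q => -(K₀ q.1 *ᵥ block q.1 (x τ)) q.2 + d τ q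

namespace PartitionedSystem

variable {N : ℕ} {n m : Fin N → ℕ} (sys : PartitionedSystem n m)

/-- `x` is a (Carathéodory) solution of `ẋ = f(x) + g(x) u` on `[a, b]`. -/
def IsSolutionOn (u : ℝ → BlockIdx m → ℝ) (x : ℝ → BlockIdx n → ℝ) (a b : ℝ) : Prop :=
  MeasureTheory.IntegrableOn (fun τ => sys.f (x τ) + sys.g (x τ) *ᵥ u τ) (Set.Icc a b) ∧
  ∀ s ∈ Set.Icc a b, x s = x a + ∫ τ in a..s, (sys.f (x τ) + sys.g (x τ) *ᵥ u τ)

/-- The signal `g_j(x) u`. -/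
def inputSignal (j : Fin N) (u : ℝ → BlockIdx m → ℝ) (x : ℝ → BlockIdx n → ℝ) (τ : ℝ) :
    Fin (n j) → ℝ :=
  block j (sys.g (x τ) *ᵥ u τ)

/-- The drift difference `w_j = f_j(x) - A_{jj} x_j` along `x`. -/
def driftSignal (j : Fin N) (x : ℝ → BlockIdx n → ℝ) (τ : ℝ) : Fin (n j) → ℝ :=
  block j (sys.f (x τ)) - sys.Ajj j *ᵥ block j (x τ)

/-- The matrix `W_{i,j} = W (I ⊗ B_{jj} K_{i,j}) W_r⁻¹`, for the controller `K = K_{i,j}`. -/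
def Wij (j : Fin N) (K : Matrix (Fin (m j)) (Fin (n j)) ℝ) :
    Matrix (UpperIdx (n j)) (UpperIdx (n j)) ℝ :=
  Wmat (n j) * Matrix.kronecker (1 : Matrix (Fin (n j)) (Fin (n j)) ℝ) (sys.Bjj j * K)
    * WrInv (n j)

/-- The regression matrix `Θ_{i,j}`, for the controller `K = K_{i,j}`. -/
def Theta (j : Fin N) {l : ℕ} (t : Fin (l + 1) → ℝ) (u : ℝ → BlockIdx m → ℝ)
    (x : ℝ → BlockIdx n → ℝ) (K : Matrix (Fin (m j)) (Fin (n j)) ℝ) :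
    Matrix (Fin l) (UpperIdx (n j)) ℝ :=
  deltaMat t (fun τ => block j (x τ)) (fun τ => block j (x τ))
    - (2 : ℝ) • (intMat t (fun τ => block j (x τ)) (fun τ => block j (x τ)) * (sys.Wij j K)ᵀ
        + intMat t (fun τ => block j (x τ)) (sys.inputSignal j u x)
        + intMat t (fun τ => block j (x τ)) (sys.driftSignal j x))

end PartitionedSystem

/-- The regression target `Ξ_{i,j}` for the controller `K = K_{i,j}` and loop state `xj`. -/
def Xi {n m l : ℕ} (t : Fin (l + 1) → ℝ) (xj : ℝ → Fin n → ℝ)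
    (Q : Matrix (Fin n) (Fin n) ℝ) (R : Matrix (Fin m) (Fin m) ℝ)
    (K : Matrix (Fin m) (Fin n) ℝ) : Fin l → ℝ :=
  -(intMat t xj xj *ᵥ vec (Q + Kᵀ * R * K))

/-- `θ` is a least-squares solution of `Θ θ = Ξ`. -/
def IsLeastSquares {r c : Type*} [Fintype r] [Fintype c] (Θ : Matrix r c ℝ) (Ξ : r → ℝ)
    (θ : c → ℝ) : Prop :=
  ∀ η : c → ℝ, ∑ k, ((Θ *ᵥ θ - Ξ) k) ^ 2 ≤ ∑ k, ((Θ *ᵥ η - Ξ) k) ^ 2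

/-- `(P, K)` are sequences produced in loop `j` by the dEIRL algorithm from the data `(x, u)`
sampled at `t`: at each iteration the regression is solved in the least-squares sense for `v(P_i)`,
the symmetric matrix `P_i` is recovered from `v(P_i)`, and the controller is updated. -/
def IsDEIRLSeq {N : ℕ} {n m : Fin N → ℕ} (sys : PartitionedSystem n m) (j : Fin N)
    (Q : Matrix (Fin (n j)) (Fin (n j)) ℝ) (R : Matrix (Fin (m j)) (Fin (m j)) ℝ)
    (K₀ : Matrix (Fin (m j)) (Fin (n j)) ℝ) {l : ℕ} (t : Fin (l + 1) → ℝ)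
    (u : ℝ → BlockIdx m → ℝ) (x : ℝ → BlockIdx n → ℝ)
    (P : ℕ → Matrix (Fin (n j)) (Fin (n j)) ℝ)
    (K : ℕ → Matrix (Fin (m j)) (Fin (n j)) ℝ) : Prop :=
  K 0 = K₀ ∧ ∀ i : ℕ,
    ((P i).IsSymm ∧
      IsLeastSquares (sys.Theta j t u x (K i)) (Xi t (fun τ => block j (x τ)) Q R (K i))
        (vec (P i))) ∧
    K (i + 1) = R⁻¹ * (sys.Bjj j)ᵀ * P i

end

end DEIRL

namespace DEIRL

open scoped ComplexOrder

/-! ### Eigenvectors and Hurwitz matrices -/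

/-! Write `M = A_jj - B_jj K`. Since `w_j` is by definition the part of the drift not explained by
`A_jj x_j`, the identity `ẋ_j = A_jj x_j + g_j u + w_j` is exact, whatever the coupling. The product
rule for `x_jᵀ P x_j` with `P` symmetric then gives `Θ v(P) = I_𝓑 v(Mᵀ P + P M)`
(`Theta_mulVec_vec`). As `I_𝓑` has full column rank and `v` is injective on symmetric matrices, `Θ
v(P) = Ξ` is equivalent to the Lyapunov equation for `K` (`Theta_mulVec_vec_eq_Xi_iff`). For a
stabilizing `K` that equation is solvable, so the least-squares residual is zero and the regression
has the same unique solution as Kleinman's step; induction (`iteration_unique`) identifies the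
sequences.

What remains is Kleinman's theorem. Lyapunov equations are treated through the Cayley transform `C`
of `M`, which turns them into `P - Cᵀ P C = N` with `C ^ k → 0`: uniqueness and positivity follow by
iteration, without matrix exponentials. One completion of squares (`SolvesALE.complete_square`) then
yields stability of the improved gain, monotonicity, and the lower bound by Riccati solutions. The
monotone sequence converges, its limit solves the Riccati equation, and detectability makes that
solution stabilizing, hence unique. -/

theorem mem_spectrum_iff_exists_mulVec {n : ℕ} (M : Matrix (Fin n) (Fin n) ℂ) (z : ℂ) :
    z ∈ spectrum ℂ M ↔ ∃ v ≠ 0, M *ᵥ v = z • v := by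
  rw [spectrum.mem_iff, Matrix.isUnit_iff_isUnit_det, isUnit_iff_ne_zero, not_not,
    ← Matrix.exists_mulVec_eq_zero_iff]
  refine exists_congr fun v => and_congr_right fun _ => ?_
  rw [Matrix.sub_mulVec, sub_eq_zero, Algebra.algebraMap_eq_smul_one, Matrix.smul_mulVec,
    Matrix.one_mulVec, eq_comm]

/-- The complexification of a real matrix. -/
noncomputable abbrev toComplex {m n : Type*} (M : Matrix m n ℝ) : Matrix m n ℂ :=
  M.map (algebraMap ℝ ℂ)

theorem toComplex_mul {l m n : Type*} [Fintype m] (A : Matrix l m ℝ) (B : Matrix m n ℝ) :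
    toComplex (A * B) = toComplex A * toComplex B := Matrix.map_mul

theorem toComplex_add {m n : Type*} (A B : Matrix m n ℝ) :
    toComplex (A + B) = toComplex A + toComplex B := by
  ext; simp [toComplex]

theorem toComplex_sub {m n : Type*} (A B : Matrix m n ℝ) :
    toComplex (A - B) = toComplex A - toComplex B := by
  ext; simp [toComplex]

theorem toComplex_transpose {m n : Type*} (A : Matrix m n ℝ) :
    toComplex Aᵀ = (toComplex A)ᴴ := by
  ext; simp [toComplex]

theorem isHurwitz_iff {n : ℕ} (M : Matrix (Fin n) (Fin n) ℝ) :
    IsHurwitz M ↔ ∀ (z : ℂ) (v : Fin n → ℂ), v ≠ 0 → toComplex M *ᵥ v = z • v → z.re < 0 := by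
  refine forall_congr' fun z => ?_
  rw [mem_spectrum_iff_exists_mulVec]
  exact ⟨fun h v hv hz => h ⟨v, hv, hz⟩, fun h ⟨v, hv, hz⟩ => h v hv hz⟩

section Powers

attribute [local instance] Matrix.linftyOpNormedRing Matrix.linftyOpNormedAlgebra

/-- By Gelfand's formula `‖a ^ k‖ ^ (1 / k)` is eventually below some `r < 1`, so the powers are
dominated by `r ^ k`. -/
theorem norm_pow_tendsto_zero_of_spectralRadius_lt_one {A : Type*} [NormedRing A]
    [NormedAlgebra ℂ A] [CompleteSpace A] (a : A) (h : spectralRadius ℂ a < 1) :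
    Filter.Tendsto (fun k => ‖a ^ k‖) Filter.atTop (𝓝 0) := by
  obtain ⟨r, hr, hr1⟩ := ENNReal.lt_iff_exists_nnreal_btwn.1 h
  have hr1' : (r : ℝ) < 1 := by exact_mod_cast hr1
  have h1 := spectrum.pow_nnnorm_pow_one_div_tendsto_nhds_spectralRadius a
  have h2 := h1.eventually (gt_mem_nhds hr)
  refine squeeze_zero' (Filter.Eventually.of_forall fun _ => norm_nonneg _) ?_
    (tendsto_pow_atTop_nhds_zero_of_lt_one r.2 hr1')
  filter_upwards [h2, Filter.eventually_gt_atTop 0] with k hk hk0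
  have hk' : (k : ℝ) ≠ 0 := by positivity
  have h3 := ENNReal.rpow_le_rpow hk.le (Nat.cast_nonneg (α := ℝ) k)
  rw [← ENNReal.rpow_mul, one_div, inv_mul_cancel₀ hk', ENNReal.rpow_one,
    ENNReal.rpow_natCast] at h3
  exact_mod_cast h3

theorem pow_apply_tendsto_zero {n : ℕ} (C : Matrix (Fin n) (Fin n) ℂ)
    (hC : ∀ (z : ℂ) (v : Fin n → ℂ), v ≠ 0 → C *ᵥ v = z • v → ‖z‖ < 1) (i j : Fin n) :
    Filter.Tendsto (fun k => (C ^ k) i j) Filter.atTop (𝓝 0) := by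
  -- Makes the matrix ring nontrivial, so that the spectrum is nonempty and the bound on the
  -- spectral radius is strict.
  have : Nonempty (Fin n) := ⟨i⟩
  have h1 : spectralRadius ℂ C < (1 : NNReal) := by
    refine spectrum.spectralRadius_lt_of_forall_lt C fun z hz => ?_
    obtain ⟨v, hv, hz⟩ := (mem_spectrum_iff_exists_mulVec C z).1 hz
    exact hC z v hv hz
  have h2 := norm_pow_tendsto_zero_of_spectralRadius_lt_one C (by simpa using h1)
  refine squeeze_zero_norm (fun k => ?_) h2
  have h3 : ‖(C ^ k) i j‖₊ ≤ ‖C ^ k‖₊ := by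
    rw [Matrix.linfty_opNNNorm_def]
    refine le_trans ?_ (Finset.le_sup (f := fun i => ∑ j, ‖(C ^ k) i j‖₊) (Finset.mem_univ i))
    exact Finset.single_le_sum (f := fun j => ‖(C ^ k) i j‖₊) (fun _ _ => zero_le)
      (Finset.mem_univ j)
  exact h3

end Powers

theorem pow_tendsto_zero {n : ℕ} (C : Matrix (Fin n) (Fin n) ℝ)
    (hC : ∀ (z : ℂ) (v : Fin n → ℂ), v ≠ 0 → toComplex C *ᵥ v = z • v → ‖z‖ < 1) :
    Filter.Tendsto (fun k => C ^ k) Filter.atTop (𝓝 0) := by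
  refine tendsto_pi_nhds.2 fun i => tendsto_pi_nhds.2 fun j => ?_
  have h := pow_apply_tendsto_zero (toComplex C) hC i j
  have h2 : ∀ k, (toComplex C ^ k) i j = (((C ^ k) i j : ℝ) : ℂ) := by
    intro k
    have : toComplex (C ^ k) = toComplex C ^ k :=
      map_pow (RingHom.mapMatrix (algebraMap ℝ ℂ)) C k
    rw [← this]; rfl
  simp only [h2] at h
  exact Filter.tendsto_ofReal_iff.1 (by simpa using h)

/-! ### The Lyapunov equation -/

theorem IsHurwitz.isUnit_det_one_sub {n : ℕ} {M : Matrix (Fin n) (Fin n) ℝ} (hM : IsHurwitz M) :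
    IsUnit (1 - M).det := by
  rw [isUnit_iff_ne_zero]
  intro h
  have h' : (toComplex (1 - M)).det = 0 := by
    have := RingHom.map_det (algebraMap ℝ ℂ) (1 - M)
    rw [h, map_zero] at this
    exact this.symm
  obtain ⟨v, hv, hz⟩ := Matrix.exists_mulVec_eq_zero_iff.2 h'
  have h1 : toComplex (1 : Matrix (Fin n) (Fin n) ℝ) = 1 := by simp [toComplex]
  rw [toComplex_sub, h1, Matrix.sub_mulVec, Matrix.one_mulVec, sub_eq_zero] at hz
  have := (isHurwitz_iff M).1 hM 1 v hv (by rw [one_smul]; exact hz.symm)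
  norm_num at this

/-- The Cayley transform of a matrix. -/
noncomputable def cayley {n : ℕ} (M : Matrix (Fin n) (Fin n) ℝ) : Matrix (Fin n) (Fin n) ℝ :=
  (1 + M) * (1 - M)⁻¹

/-- Multiplying by the conjugate of `1 + μ` and taking real parts gives `|1 + μ|² Re z = |μ|² - 1`.
-/
theorem norm_lt_one_of_cayley {μ z : ℂ} (h : (1 + μ) * z = μ - 1) (hμ : 1 + μ ≠ 0)
    (hz : z.re < 0) : ‖μ‖ < 1 := by
  have h1 : Complex.normSq (1 + μ) * z.re = Complex.normSq μ - 1 := by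
    have e1 := congrArg Complex.re h
    have e2 := congrArg Complex.im h
    simp only [Complex.normSq_apply, Complex.mul_re, Complex.mul_im, Complex.add_re,
      Complex.add_im, Complex.sub_re, Complex.sub_im, Complex.one_re, Complex.one_im] at *
    linear_combination (1 + μ.re) * e1 + μ.im * e2
  have h2 : 0 < Complex.normSq (1 + μ) := Complex.normSq_pos.2 hμ
  have h3 : ‖μ‖ ^ 2 < 1 := by
    rw [← Complex.normSq_eq_norm_sq]; nlinarith
  nlinarith [norm_nonneg μ]

/-- If `v` is an eigenvector of the Cayley transform for `μ`, then `w = (1 - M)⁻¹ v` is one of `M`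
for `(μ - 1) / (μ + 1)`; the value `μ = -1` would force `w = 0`. -/
theorem IsHurwitz.cayley_pow_tendsto_zero {n : ℕ} {M : Matrix (Fin n) (Fin n) ℝ}
    (hM : IsHurwitz M) : Filter.Tendsto (fun k => cayley M ^ k) Filter.atTop (𝓝 0) := by
  have hu := hM.isUnit_det_one_sub
  refine pow_tendsto_zero _ fun μ v hv h => ?_
  set J := (1 - M)⁻¹ with hJ
  have h1 : toComplex (1 : Matrix (Fin n) (Fin n) ℝ) = 1 := by simp [toComplex]
  have hJ1 : (1 - toComplex M) * toComplex J = 1 := by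
    rw [← h1, ← toComplex_sub, ← toComplex_mul, Matrix.mul_nonsing_inv _ hu]
  set w := toComplex J *ᵥ v with hw
  have hv' : v = w - toComplex M *ᵥ w := by
    have : (1 - toComplex M) *ᵥ w = v := by
      rw [hw, Matrix.mulVec_mulVec, hJ1, Matrix.one_mulVec]
    rw [← this, Matrix.sub_mulVec, Matrix.one_mulVec]
  have hw0 : w ≠ 0 := by
    intro h0; apply hv; rw [hv', h0]; simp
  have h2 : w + toComplex M *ᵥ w = μ • (w - toComplex M *ᵥ w) := by
    rw [← hv', ← h, cayley, toComplex_mul, ← Matrix.mulVec_mulVec, ← hw, toComplex_add, h1,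
      Matrix.add_mulVec, Matrix.one_mulVec]
  have h3 : (1 + μ) • (toComplex M *ᵥ w) = (μ - 1) • w := by
    have : (1 + μ) • (toComplex M *ᵥ w) - (μ - 1) • w
        = (w + toComplex M *ᵥ w) - μ • (w - toComplex M *ᵥ w) := by module
    rw [h2, sub_self] at this
    exact sub_eq_zero.1 this
  have hμ : 1 + μ ≠ 0 := by
    intro h0
    rw [h0, zero_smul] at h3
    rcases smul_eq_zero.1 h3.symm with h4 | h4
    · have : (2 : ℂ) = 0 := by linear_combination h0 - h4
      norm_num at this
    · exact hw0 h4
  have h4 : toComplex M *ᵥ w = ((1 + μ)⁻¹ * (μ - 1)) • w := by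
    rw [mul_smul, ← h3, inv_smul_smul₀ hμ]
  exact norm_lt_one_of_cayley (mul_inv_cancel_left₀ hμ _) hμ ((isHurwitz_iff M).1 hM _ w hw0 h4)

/-- Congruence by `1 - M` clears the inverses; the difference of the two expanded products keeps
only the terms linear in `M`. This links the continuous-time and discrete-time Lyapunov equations.
-/
theorem sub_cayley_conj {n : ℕ} {M : Matrix (Fin n) (Fin n) ℝ} (hM : IsHurwitz M)
    (P : Matrix (Fin n) (Fin n) ℝ) :
    P - (cayley M)ᵀ * P * cayley M =
      (2 : ℝ) • (((1 - M)⁻¹)ᵀ * (-(Mᵀ * P + P * M)) * (1 - M)⁻¹) := by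
  have hu := hM.isUnit_det_one_sub
  set J := (1 - M)⁻¹ with hJ
  have hJ1 : (1 - M) * J = 1 := Matrix.mul_nonsing_inv _ hu
  have hJ2 : Jᵀ * (1 - M)ᵀ = 1 := by rw [← Matrix.transpose_mul, hJ1, Matrix.transpose_one]
  have hP : P = Jᵀ * ((1 - M)ᵀ * P * (1 - M)) * J := by
    calc P = (Jᵀ * (1 - M)ᵀ) * P * ((1 - M) * J) := by rw [hJ1, hJ2]; simp
      _ = _ := by simp only [Matrix.mul_assoc]
  have hC : (cayley M)ᵀ * P * cayley M = Jᵀ * ((1 + M)ᵀ * P * (1 + M)) * J := by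
    rw [cayley, Matrix.transpose_mul, ← hJ]; simp only [Matrix.mul_assoc]
  have hPC : P - (cayley M)ᵀ * P * cayley M =
      Jᵀ * ((1 - M)ᵀ * P * (1 - M)) * J - Jᵀ * ((1 + M)ᵀ * P * (1 + M)) * J := by
    rw [hC, ← hP]
  rw [hPC, ← Matrix.sub_mul, ← Matrix.mul_sub, ← Matrix.smul_mul, ← Matrix.mul_smul]
  congr 2
  simp only [Matrix.transpose_sub, Matrix.transpose_add, Matrix.transpose_one]
  rw [two_smul]
  noncomm_ring

theorem tendsto_conj_pow {n : ℕ} {C : Matrix (Fin n) (Fin n) ℝ}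
    (hC : Filter.Tendsto (fun k => C ^ k) Filter.atTop (𝓝 0)) (P : Matrix (Fin n) (Fin n) ℝ) :
    Filter.Tendsto (fun k => (C ^ k)ᵀ * P * C ^ k) Filter.atTop (𝓝 0) := by
  have hc : Continuous fun X : Matrix (Fin n) (Fin n) ℝ => Xᵀ * P * X := by fun_prop
  have := (hc.tendsto 0).comp hC
  simp only [Matrix.mul_zero] at this
  exact this

/-- `P` is fixed by congruence with the Cayley transform, hence with its powers, which tend to zero.
-/
theorem IsHurwitz.eq_zero_of_lyapunov {n : ℕ} {M : Matrix (Fin n) (Fin n) ℝ} (hM : IsHurwitz M)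
    {P : Matrix (Fin n) (Fin n) ℝ} (hP : Mᵀ * P + P * M = 0) : P = 0 := by
  have h := sub_cayley_conj hM P
  rw [hP, neg_zero, Matrix.mul_zero, Matrix.zero_mul, smul_zero, sub_eq_zero] at h
  have h2 : ∀ k, (cayley M ^ k)ᵀ * P * cayley M ^ k = P := by
    intro k
    induction k with
    | zero => simp
    | succ k ih =>
      rw [pow_succ, Matrix.transpose_mul]
      calc (cayley M)ᵀ * (cayley M ^ k)ᵀ * P * (cayley M ^ k * cayley M)
          = (cayley M)ᵀ * ((cayley M ^ k)ᵀ * P * cayley M ^ k) * cayley M := by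
            simp only [Matrix.mul_assoc]
        _ = P := by rw [ih, ← h]
  have h3 := tendsto_conj_pow hM.cayley_pow_tendsto_zero P
  simp only [h2] at h3
  exact tendsto_nhds_unique tendsto_const_nhds h3

theorem isClosed_posSemidef {n : ℕ} :
    IsClosed {P : Matrix (Fin n) (Fin n) ℝ | P.PosSemidef} := by
  simp only [Matrix.posSemidef_iff_dotProduct_mulVec, Set.ofPred_and, Set.ofPred_forall]
  refine IsClosed.inter ?_ (isClosed_iInter fun x => ?_)
  · exact isClosed_eq (by fun_prop) (by fun_prop)
  · exact isClosed_le (by fun_prop) (by fun_prop)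

/-- Telescoping makes every `P - (C ^ k)ᵀ P C ^ k` positive semidefinite, and these converge to `P`
in a closed cone. Symmetry of `P` is not assumed; it also comes out of the limit. -/
theorem IsHurwitz.posSemidef_of_lyapunov {n : ℕ} {M : Matrix (Fin n) (Fin n) ℝ}
    (hM : IsHurwitz M) {P : Matrix (Fin n) (Fin n) ℝ}
    (h : (-(Mᵀ * P + P * M)).PosSemidef) : P.PosSemidef := by
  have hD : (P - (cayley M)ᵀ * P * cayley M).PosSemidef := by
    rw [sub_cayley_conj hM P]
    refine Matrix.PosSemidef.smul ?_ (by norm_num : (0 : ℝ) ≤ 2)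
    exact h.conjTranspose_mul_mul_same _
  have h2 : ∀ k, (P - (cayley M ^ k)ᵀ * P * cayley M ^ k).PosSemidef := by
    intro k
    induction k with
    | zero => simpa using Matrix.PosSemidef.zero
    | succ k ih =>
      have h3 := ih.add (hD.conjTranspose_mul_mul_same (cayley M ^ k))
      convert h3 using 1
      rw [pow_succ', Matrix.transpose_mul, Matrix.conjTranspose_eq_transpose_of_trivial,
        Matrix.mul_sub, Matrix.sub_mul]
      simp only [Matrix.mul_assoc]
      abel
  have h3 := (tendsto_const_nhds (x := P)).sub (tendsto_conj_pow hM.cayley_pow_tendsto_zero P)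
  rw [sub_zero] at h3
  exact isClosed_posSemidef.mem_of_tendsto h3 (Filter.Eventually.of_forall h2)

theorem IsHurwitz.exists_lyapunov {n : ℕ} {M : Matrix (Fin n) (Fin n) ℝ} (hM : IsHurwitz M)
    (N : Matrix (Fin n) (Fin n) ℝ) : ∃ P, Mᵀ * P + P * M = N := by
  let φ : Matrix (Fin n) (Fin n) ℝ →ₗ[ℝ] Matrix (Fin n) (Fin n) ℝ :=
    LinearMap.mulLeft ℝ Mᵀ + LinearMap.mulRight ℝ M
  have hφ : ∀ P, φ P = Mᵀ * P + P * M := fun P => rfl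
  have hinj : Function.Injective φ := by
    rw [injective_iff_map_eq_zero]
    intro P hP
    exact hM.eq_zero_of_lyapunov hP
  exact LinearMap.surjective_of_injective hinj N

theorem IsHurwitz.lyapunov_unique {n : ℕ} {M : Matrix (Fin n) (Fin n) ℝ} (hM : IsHurwitz M)
    {P P' : Matrix (Fin n) (Fin n) ℝ} (h : Mᵀ * P + P * M = Mᵀ * P' + P' * M) : P = P' := by
  refine sub_eq_zero.1 (hM.eq_zero_of_lyapunov ?_)
  rw [Matrix.mul_sub, Matrix.sub_mul, ← sub_eq_zero.2 h]
  abel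

theorem posSemidef_toComplex {n : ℕ} {P : Matrix (Fin n) (Fin n) ℝ} (hP : P.PosSemidef) :
    (toComplex P).PosSemidef := by
  open scoped MatrixOrder in
  obtain ⟨D, hD⟩ := CStarAlgebra.nonneg_iff_eq_star_mul_self.mp hP.nonneg
  rw [hD, toComplex_mul, Matrix.star_eq_conjTranspose,
    Matrix.conjTranspose_eq_transpose_of_trivial, toComplex_transpose]
  exact Matrix.posSemidef_conjTranspose_mul_self _

/-- An eigenvector for an eigenvalue in the closed right half plane is annihilated by the right-hand
side of a Lyapunov equation with positive semidefinite solution. -/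
theorem mulVec_eq_zero_of_lyapunov {n : ℕ} {M P N : Matrix (Fin n) (Fin n) ℝ}
    (hP : P.PosSemidef) (hN : N.PosSemidef) (h : Mᵀ * P + P * M + N = 0) {z : ℂ}
    {v : Fin n → ℂ} (hz : 0 ≤ z.re) (hv : toComplex M *ᵥ v = z • v) : toComplex N *ᵥ v = 0 := by
  have hP' := posSemidef_toComplex hP
  have hN' := posSemidef_toComplex hN
  refine (hN'.dotProduct_mulVec_zero_iff v).1 ?_
  have hh : (toComplex M)ᴴ * toComplex P + toComplex P * toComplex M + toComplex N = 0 := by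
    rw [← toComplex_transpose, ← toComplex_mul, ← toComplex_mul, ← toComplex_add,
      ← toComplex_add, h]
    simp [toComplex]
  have h1 : star v ⬝ᵥ ((toComplex M)ᴴ * toComplex P + toComplex P * toComplex M
      + toComplex N) *ᵥ v = 0 := by rw [hh]; simp
  rw [Matrix.add_mulVec, Matrix.add_mulVec, dotProduct_add, dotProduct_add,
    ← Matrix.mulVec_mulVec, ← Matrix.mulVec_mulVec, hv, Matrix.dotProduct_mulVec _ _ (_ *ᵥ v),
    ← Matrix.star_mulVec, hv, Matrix.mulVec_smul, dotProduct_smul, star_smul, smul_dotProduct,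
    ← add_smul] at h1
  have h2 := hP'.dotProduct_mulVec_nonneg v
  have h3 := hN'.dotProduct_mulVec_nonneg v
  -- The quadratic form at `v` is now `(star z + z) v*Pv + v*Nv = 0`, a sum of two nonnegative
  -- terms.
  have h4 : star z + z = ((2 * z.re : ℝ) : ℂ) := by
    rw [add_comm]; exact Complex.add_conj z
  rw [h4, smul_eq_mul] at h1
  have h5 : (0 : ℂ) ≤ ((2 * z.re : ℝ) : ℂ) := by exact_mod_cast (by positivity)
  have h6 := mul_nonneg h5 h2
  exact ((add_eq_zero_iff_of_nonneg h6 h3).1 h1).2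

theorem posSemidef_add_mulVec_eq_zero {n : ℕ} {X Y : Matrix (Fin n) (Fin n) ℂ}
    (hX : X.PosSemidef) (hY : Y.PosSemidef) {v : Fin n → ℂ} (h : (X + Y) *ᵥ v = 0) :
    X *ᵥ v = 0 ∧ Y *ᵥ v = 0 := by
  have h1 : star v ⬝ᵥ X *ᵥ v + star v ⬝ᵥ Y *ᵥ v = 0 := by
    rw [← dotProduct_add, ← Matrix.add_mulVec, h, dotProduct_zero]
  have h2 := (add_eq_zero_iff_of_nonneg (hX.dotProduct_mulVec_nonneg v)
    (hY.dotProduct_mulVec_nonneg v)).1 h1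
  exact ⟨(hX.dotProduct_mulVec_zero_iff v).1 h2.1, (hY.dotProduct_mulVec_zero_iff v).1 h2.2⟩

/-- The form of `R` vanishes at `K v`, so `R K v = 0` by semidefiniteness over `ℂ`, and `R` is
invertible. -/
theorem mulVec_eq_zero_of_conj {n m : ℕ} {R : Matrix (Fin m) (Fin m) ℝ} (hR : R.PosDef)
    {K : Matrix (Fin m) (Fin n) ℝ} {v : Fin n → ℂ} (h : toComplex (Kᵀ * R * K) *ᵥ v = 0) :
    toComplex K *ᵥ v = 0 := by
  have hR' := posSemidef_toComplex hR.posSemidef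
  have h1 : star (toComplex K *ᵥ v) ⬝ᵥ toComplex R *ᵥ (toComplex K *ᵥ v) = 0 := by
    rw [Matrix.star_mulVec, ← toComplex_transpose, ← Matrix.dotProduct_mulVec,
      Matrix.mulVec_mulVec, Matrix.mulVec_mulVec, ← toComplex_mul, ← toComplex_mul,
      h, dotProduct_zero]
  have h2 := (hR'.dotProduct_mulVec_zero_iff _).1 h1
  have h3 : toComplex R⁻¹ * toComplex R = 1 := by
    rw [← toComplex_mul, Matrix.nonsing_inv_mul _ ((Matrix.isUnit_iff_isUnit_det _).1 hR.isUnit)]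
    simp [toComplex]
  rw [← Matrix.one_mulVec (toComplex K *ᵥ v), ← h3, ← Matrix.mulVec_mulVec, h2,
    Matrix.mulVec_zero]

/-! ### Policy iteration -/

section PolicyIteration

variable {n m : ℕ} {A : Matrix (Fin n) (Fin n) ℝ} {B : Matrix (Fin n) (Fin m) ℝ}
  {Q : Matrix (Fin n) (Fin n) ℝ} {R : Matrix (Fin m) (Fin m) ℝ}

theorem posSemidef_isSymm {k : ℕ} {P : Matrix (Fin k) (Fin k) ℝ} (hP : P.PosSemidef) :
    Pᵀ = P := by
  simpa using hP.isHermitian.eq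

theorem transpose_mul_eq_gain (hR : R.PosDef) (P : Matrix (Fin n) (Fin n) ℝ) :
    Bᵀ * P = R * (R⁻¹ * Bᵀ * P) := by
  rw [Matrix.mul_assoc, Matrix.mul_nonsing_inv_cancel_left _ _
    ((Matrix.isUnit_iff_isUnit_det _).1 hR.isUnit)]

theorem mul_eq_gain_transpose (hR : R.PosDef) {P : Matrix (Fin n) (Fin n) ℝ} (hP : Pᵀ = P) :
    P * B = (R⁻¹ * Bᵀ * P)ᵀ * R := by
  have h := congrArg Matrix.transpose (transpose_mul_eq_gain (B := B) hR P)
  rwa [Matrix.transpose_mul, Matrix.transpose_mul, hP, Matrix.transpose_transpose,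
    posSemidef_isSymm hR.posSemidef] at h

/-- Completion of squares: a solution of the Lyapunov equation for the gain `K`, seen from another
gain `L`. -/
theorem SolvesALE.complete_square (hR : R.PosDef) {K K' : Matrix (Fin m) (Fin n) ℝ}
    {P : Matrix (Fin n) (Fin n) ℝ} (hP : Pᵀ = P) (h : SolvesALE A B Q R K P)
    (hK' : K' = R⁻¹ * Bᵀ * P) (L : Matrix (Fin m) (Fin n) ℝ) :
    (A - B * L)ᵀ * P + P * (A - B * L) + (Lᵀ * R * L + Q) + (K - K')ᵀ * R * (K - K')
      - (L - K')ᵀ * R * (L - K') = 0 := by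
  have h1 : Bᵀ * P = R * K' := hK' ▸ transpose_mul_eq_gain hR P
  have h2 : P * B = K'ᵀ * R := hK' ▸ mul_eq_gain_transpose hR hP
  have h3 : ∀ L : Matrix (Fin m) (Fin n) ℝ, (A - B * L)ᵀ * P + P * (A - B * L) =
      Aᵀ * P + P * A - (Lᵀ * R * K' + K'ᵀ * R * L) := by
    intro L
    rw [Matrix.transpose_sub, Matrix.sub_mul, Matrix.mul_sub, Matrix.transpose_mul,
      Matrix.mul_assoc, h1, ← Matrix.mul_assoc P B L, h2, Matrix.mul_assoc Lᵀ]
    abel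
  rw [SolvesALE, h3] at h
  rw [h3, ← h]
  simp only [Matrix.transpose_sub, Matrix.sub_mul, Matrix.mul_sub]
  abel

/-- For the gain `K` built from `X`, each of the two feedback terms contributes `-Kᵀ R K`; together
with the cost `Kᵀ R K` they leave the quadratic term of the Riccati equation. -/
theorem solvesCARE_iff_solvesALE (hR : R.PosDef) {X : Matrix (Fin n) (Fin n) ℝ} (hX : Xᵀ = X) :
    SolvesCARE A B Q R X ↔ SolvesALE A B Q R (R⁻¹ * Bᵀ * X) X := by
  set K := R⁻¹ * Bᵀ * X with hK
  have h1 : Bᵀ * X = R * K := transpose_mul_eq_gain hR X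
  have h2 : X * B = Kᵀ * R := mul_eq_gain_transpose hR hX
  have h3 : X * B * R⁻¹ * Bᵀ * X = Kᵀ * R * K := by
    rw [h2, hK]; simp only [Matrix.mul_assoc]
  have h4 : (A - B * K)ᵀ * X = Aᵀ * X - Kᵀ * R * K := by
    rw [Matrix.transpose_sub, Matrix.sub_mul, Matrix.transpose_mul, Matrix.mul_assoc, h1,
      ← Matrix.mul_assoc]
  have h5 : X * (A - B * K) = X * A - Kᵀ * R * K := by
    rw [Matrix.mul_sub, ← Matrix.mul_assoc, h2]
  rw [SolvesCARE, SolvesALE, h3, h4, h5]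
  refine Eq.congr_left ?_
  abel

theorem posSemidef_conj (hR : R.PosDef) (K : Matrix (Fin m) (Fin n) ℝ) :
    (Kᵀ * R * K).PosSemidef :=
  hR.posSemidef.conjTranspose_mul_mul_same K

/-- Policy improvement preserves stability. -/
theorem IsHurwitz.improved_gain (hQ : Q.PosSemidef) (hR : R.PosDef)
    {K : Matrix (Fin m) (Fin n) ℝ} {P : Matrix (Fin n) (Fin n) ℝ} (hP : P.PosSemidef)
    (h : SolvesALE A B Q R K P) (hK : IsHurwitz (A - B * K)) :
    IsHurwitz (A - B * (R⁻¹ * Bᵀ * P)) := by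
  set K' := R⁻¹ * Bᵀ * P with hK'
  have hsq := h.complete_square hR (posSemidef_isSymm hP) hK' K'
  rw [sub_self K', Matrix.mul_zero, sub_zero, add_assoc] at hsq
  have hN1 := (posSemidef_conj hR K').add hQ
  have hN2 := posSemidef_conj hR (K - K')
  rw [isHurwitz_iff]
  intro z v hv hz
  by_contra hre
  -- An unstable eigenvector `v` of the new closed loop satisfies `(K - K') v = 0`, so the old
  -- closed loop acts on it in the same way, against its stability.
  have h1 := mulVec_eq_zero_of_lyapunov hP (hN1.add hN2) hsq (not_lt.1 hre) hz
  rw [toComplex_add] at h1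
  have h2 := (posSemidef_add_mulVec_eq_zero (posSemidef_toComplex hN1)
    (posSemidef_toComplex hN2) h1).2
  have h3 := mulVec_eq_zero_of_conj hR h2
  have h4 : A - B * K = A - B * K' - B * (K - K') := by
    rw [Matrix.mul_sub]; abel
  refine hre ((isHurwitz_iff _).1 hK z v hv ?_)
  rw [h4, toComplex_sub, Matrix.sub_mulVec, hz, toComplex_mul, ← Matrix.mulVec_mulVec, h3,
    Matrix.mulVec_zero, sub_zero]

theorem lyapunov_sub {M P P' N N' : Matrix (Fin n) (Fin n) ℝ} (h : Mᵀ * P + P * M + N = 0)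
    (h' : Mᵀ * P' + P' * M + N' = 0) :
    -(Mᵀ * (P - P') + (P - P') * M) = N - N' := by
  rw [Matrix.mul_sub, Matrix.sub_mul, eq_neg_of_add_eq_zero_right h,
    eq_neg_of_add_eq_zero_right h']
  abel

theorem SolvesALE.lyapunov {K : Matrix (Fin m) (Fin n) ℝ} {P : Matrix (Fin n) (Fin n) ℝ}
    (h : SolvesALE A B Q R K P) :
    (A - B * K)ᵀ * P + P * (A - B * K) + (Kᵀ * R * K + Q) = 0 := by
  rwa [SolvesALE, add_assoc] at h

/-- Policy improvement decreases the cost. -/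
theorem SolvesALE.sub_improved_posSemidef (hR : R.PosDef) {K K' : Matrix (Fin m) (Fin n) ℝ}
    {P P' : Matrix (Fin n) (Fin n) ℝ} (hP : P.PosSemidef) (h : SolvesALE A B Q R K P)
    (hK' : K' = R⁻¹ * Bᵀ * P) (h' : SolvesALE A B Q R K' P')
    (hH : IsHurwitz (A - B * K')) : (P - P').PosSemidef := by
  have hsq := h.complete_square hR (posSemidef_isSymm hP) hK' K'
  rw [sub_self K', Matrix.mul_zero, sub_zero, add_assoc] at hsq
  refine hH.posSemidef_of_lyapunov ?_
  -- Both costs satisfy Lyapunov equations for the closed loop of `K'`; the source terms differ by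
  -- `(K - K')ᵀ R (K - K')`.
  rw [lyapunov_sub hsq h'.lyapunov, add_sub_cancel_left]
  exact posSemidef_conj hR _

/-! ### Solutions of the Riccati equation -/

/-- A positive semidefinite solution of the Riccati equation is a lower bound of the cost of every
stabilizing gain. -/
theorem SolvesCARE.sub_posSemidef (hR : R.PosDef) {K : Matrix (Fin m) (Fin n) ℝ}
    {P X : Matrix (Fin n) (Fin n) ℝ} (hX : X.PosSemidef) (hC : SolvesCARE A B Q R X)
    (h : SolvesALE A B Q R K P) (hH : IsHurwitz (A - B * K)) : (P - X).PosSemidef := by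
  -- `X` is the Lyapunov solution for its own gain, so one of the two squares vanishes and the other
  -- is the excess cost of `K`.
  have hsq := ((solvesCARE_iff_solvesALE hR (posSemidef_isSymm hX)).1 hC).complete_square hR
    (posSemidef_isSymm hX) rfl K
  rw [sub_self (R⁻¹ * Bᵀ * X), Matrix.mul_zero, add_zero, add_sub_assoc] at hsq
  refine hH.posSemidef_of_lyapunov ?_
  rw [lyapunov_sub h.lyapunov hsq, sub_sub_cancel]
  exact posSemidef_conj hR _

theorem toComplex_mulVec_eq_zero_of_sqrt {S : Matrix (Fin n) (Fin n) ℝ} (hS : IsPSDSqrt Q S)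
    {v : Fin n → ℂ} (h : toComplex Q *ᵥ v = 0) : toComplex S *ᵥ v = 0 := by
  rw [← hS.2, toComplex_mul] at h
  nth_rw 1 [← posSemidef_isSymm hS.1] at h
  rw [toComplex_transpose] at h
  exact (Matrix.conjTranspose_mul_self_mulVec_eq_zero _ _).1 h

theorem mulVec_eq_zero_of_sqrt {S : Matrix (Fin n) (Fin n) ℝ} (hS : IsPSDSqrt Q S)
    {v : Fin n → ℝ} (h : Q *ᵥ v = 0) : S *ᵥ v = 0 := by
  rw [← hS.2] at h
  nth_rw 1 [← hS.1.isHermitian.eq] at h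
  exact (Matrix.conjTranspose_mul_self_mulVec_eq_zero _ _).1 h

/-- Under detectability, positive semidefinite solutions of the Riccati equation are stabilizing. -/
theorem SolvesCARE.isHurwitz (hQ : Q.PosSemidef) (hR : R.PosDef)
    {S X : Matrix (Fin n) (Fin n) ℝ} (hS : IsPSDSqrt Q S) (hD : IsDetectable S A)
    (hX : X.PosSemidef) (hC : SolvesCARE A B Q R X) :
    IsHurwitz (A - B * (R⁻¹ * Bᵀ * X)) := by
  obtain ⟨L, hL⟩ := hD
  have hA := ((solvesCARE_iff_solvesALE hR (posSemidef_isSymm hX)).1 hC).lyapunov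
  set K := R⁻¹ * Bᵀ * X
  have hN := posSemidef_conj hR K
  rw [isHurwitz_iff]
  intro z v hv hz
  by_contra hre
  -- An unstable eigenvector is killed by `K` and by `S`, so it is also an eigenvector of `A - L *
  -- S` for the same eigenvalue, against the choice of `L`.
  have h1 := mulVec_eq_zero_of_lyapunov hX (hN.add hQ) hA (not_lt.1 hre) hz
  rw [toComplex_add] at h1
  obtain ⟨h2, h3⟩ := posSemidef_add_mulVec_eq_zero (posSemidef_toComplex hN)
    (posSemidef_toComplex hQ) h1
  have h4 := mulVec_eq_zero_of_conj hR h2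
  have h5 := toComplex_mulVec_eq_zero_of_sqrt hS h3
  refine hre ((isHurwitz_iff _).1 hL z v hv ?_)
  have h6 : A - L * S = A - B * K + B * K - L * S := by abel
  rw [h6, toComplex_sub, toComplex_add, Matrix.sub_mulVec, Matrix.add_mulVec, hz, toComplex_mul,
    ← Matrix.mulVec_mulVec, h4, toComplex_mul, ← Matrix.mulVec_mulVec, h5, Matrix.mulVec_zero,
    Matrix.mulVec_zero, add_zero, sub_zero]

theorem eq_of_sub_posSemidef {X Y : Matrix (Fin n) (Fin n) ℝ} (h : (X - Y).PosSemidef)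
    (h' : (Y - X).PosSemidef) : X = Y := by
  open scoped MatrixOrder in
  exact le_antisymm (Matrix.le_iff.2 h') (Matrix.le_iff.2 h)

/-- Each solution is the cost of its own stabilizing gain, and so is bounded below by the other. -/
theorem SolvesCARE.unique (hQ : Q.PosSemidef) (hR : R.PosDef)
    {S X Y : Matrix (Fin n) (Fin n) ℝ} (hS : IsPSDSqrt Q S) (hD : IsDetectable S A)
    (hX : X.PosSemidef) (hCX : SolvesCARE A B Q R X) (hY : Y.PosSemidef)
    (hCY : SolvesCARE A B Q R Y) : X = Y :=
  eq_of_sub_posSemidef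
    (hCY.sub_posSemidef hR hY ((solvesCARE_iff_solvesALE hR (posSemidef_isSymm hX)).1 hCX)
      (hCX.isHurwitz hQ hR hS hD hX))
    (hCX.sub_posSemidef hR hX ((solvesCARE_iff_solvesALE hR (posSemidef_isSymm hY)).1 hCY)
      (hCY.isHurwitz hQ hR hS hD hY))

theorem posDef_of_mulVec_eq_zero {X : Matrix (Fin n) (Fin n) ℝ} (hX : X.PosSemidef)
    (h : ∀ v, X *ᵥ v = 0 → v = 0) : X.PosDef :=
  Matrix.PosDef.of_dotProduct_mulVec_pos hX.isHermitian fun v hv =>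
    lt_of_le_of_ne (hX.dotProduct_mulVec_nonneg v) fun h0 =>
      hv (h v ((hX.dotProduct_mulVec_zero_iff v).1 h0.symm))

/-- Under observability, positive semidefinite solutions of the Riccati equation are positive
definite. -/
theorem SolvesCARE.posDef (hQ : Q.PosSemidef) {S X : Matrix (Fin n) (Fin n) ℝ}
    (hS : IsPSDSqrt Q S) (hO : IsObservable S A) (hX : X.PosSemidef)
    (hC : SolvesCARE A B Q R X) : X.PosDef := by
  -- The kernel of `X` is `A`-invariant and lies in that of `Q`: on it the Riccati equation reads `X
  -- A v + Q v = 0`, and pairing with `v` removes the first term. Observability then makes this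
  -- kernel trivial.
  have key : ∀ v, X *ᵥ v = 0 → Q *ᵥ v = 0 ∧ X *ᵥ (A *ᵥ v) = 0 := by
    intro v hv
    have h1 : X *ᵥ (A *ᵥ v) + Q *ᵥ v = 0 := by
      have h2 := congrArg (· *ᵥ v) hC
      simp only [Matrix.add_mulVec, Matrix.sub_mulVec, ← Matrix.mulVec_mulVec, hv,
        Matrix.mulVec_zero, Matrix.zero_mulVec, zero_add, sub_zero] at h2
      exact h2
    have h3 : v ⬝ᵥ X *ᵥ (A *ᵥ v) = 0 := by
      rw [Matrix.dotProduct_mulVec, ← Matrix.mulVec_transpose, posSemidef_isSymm hX, hv,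
        zero_dotProduct]
    have h4 : v ⬝ᵥ Q *ᵥ v = 0 := by
      have h5 := congrArg (v ⬝ᵥ ·) h1
      simpa only [dotProduct_add, h3, zero_add, dotProduct_zero] using h5
    have h6 : Q *ᵥ v = 0 := (hQ.dotProduct_mulVec_zero_iff v).1 (by simpa using h4)
    exact ⟨h6, by simpa [h6] using h1⟩
  refine posDef_of_mulVec_eq_zero hX fun v hv => hO v fun k => ?_
  have h7 : ∀ k : ℕ, X *ᵥ (A ^ k *ᵥ v) = 0 := by
    intro k
    induction k with
    | zero => simpa using hv
    | succ k ih => rw [pow_succ', ← Matrix.mulVec_mulVec]; exact (key _ ih).2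
  exact mulVec_eq_zero_of_sqrt hS (key _ (h7 k)).1

/-! ### Convergence of Kleinman's sequences -/

theorem dotProduct_mulVec_add_self {P : Matrix (Fin n) (Fin n) ℝ} (hP : Pᵀ = P)
    (x y : Fin n → ℝ) :
    (x + y) ⬝ᵥ P *ᵥ (x + y) = x ⬝ᵥ P *ᵥ x + 2 * (x ⬝ᵥ P *ᵥ y) + y ⬝ᵥ P *ᵥ y := by
  have h : y ⬝ᵥ P *ᵥ x = x ⬝ᵥ P *ᵥ y := by
    rw [Matrix.dotProduct_mulVec, ← Matrix.mulVec_transpose, hP, dotProduct_comm]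
  simp only [Matrix.mulVec_add, dotProduct_add, add_dotProduct, h]
  ring

/-- A nonincreasing sequence of positive semidefinite matrices converges. -/
theorem exists_tendsto_of_antitone {P : ℕ → Matrix (Fin n) (Fin n) ℝ}
    (hP : ∀ i, (P i).PosSemidef) (hd : ∀ i, (P i - P (i + 1)).PosSemidef) :
    ∃ X, Filter.Tendsto P Filter.atTop (𝓝 X) := by
  have hq : ∀ v, ∃ c : ℝ, Filter.Tendsto (fun i => v ⬝ᵥ P i *ᵥ v) Filter.atTop (𝓝 c) := by
    intro v
    refine ⟨_, tendsto_atTop_ciInf (antitone_nat_of_succ_le fun i => ?_) ⟨0, ?_⟩⟩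
    · have h := (hd i).dotProduct_mulVec_nonneg v
      rw [Matrix.sub_mulVec, dotProduct_sub] at h
      simpa using h
    · rintro _ ⟨i, rfl⟩
      simpa using (hP i).dotProduct_mulVec_nonneg v
  choose c hc using hq
  -- Polarization recovers the entries from the quadratic forms, which converge because they
  -- decrease and are nonnegative.
  have he : ∀ i a b, P i a b = (((Pi.single a 1 + Pi.single b 1) ⬝ᵥ
      P i *ᵥ (Pi.single a 1 + Pi.single b 1)) - Pi.single a 1 ⬝ᵥ P i *ᵥ Pi.single a 1
      - Pi.single b 1 ⬝ᵥ P i *ᵥ Pi.single b 1) / 2 := by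
    intro i a b
    rw [dotProduct_mulVec_add_self (posSemidef_isSymm (hP i))]
    simp
    ring
  refine ⟨fun a b => (c (Pi.single a 1 + Pi.single b 1) - c (Pi.single a 1)
    - c (Pi.single b 1)) / 2, tendsto_pi_nhds.2 fun a => tendsto_pi_nhds.2 fun b => ?_⟩
  simp only [he]
  exact (((hc _).sub (hc _)).sub (hc _)).div_const 2

theorem IsHurwitz.exists_solvesALE (hQ : Q.PosSemidef) (hR : R.PosDef)
    {K : Matrix (Fin m) (Fin n) ℝ} (hK : IsHurwitz (A - B * K)) :
    ∃ P : Matrix (Fin n) (Fin n) ℝ, P.PosSemidef ∧ SolvesALE A B Q R K P := by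
  obtain ⟨P, hP⟩ := hK.exists_lyapunov (-(Kᵀ * R * K + Q))
  refine ⟨P, hK.posSemidef_of_lyapunov ?_, ?_⟩
  · rw [hP, neg_neg]
    exact (posSemidef_conj hR K).add hQ
  · rw [SolvesALE, add_assoc, hP, neg_add_cancel]

theorem SolvesALE.unique {K : Matrix (Fin m) (Fin n) ℝ} {P P' : Matrix (Fin n) (Fin n) ℝ}
    (hK : IsHurwitz (A - B * K)) (h : SolvesALE A B Q R K P) (h' : SolvesALE A B Q R K P') :
    P = P' := by
  refine hK.lyapunov_unique ?_
  rw [eq_neg_of_add_eq_zero_left h.lyapunov, eq_neg_of_add_eq_zero_left h'.lyapunov]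

theorem exists_isKleinmanSeq (hQ : Q.PosSemidef) (hR : R.PosDef)
    {K₀ : Matrix (Fin m) (Fin n) ℝ} (hK₀ : IsHurwitz (A - B * K₀)) :
    ∃ P K, IsKleinmanSeq A B Q R K₀ P K := by
  -- The recursion runs on stabilizing gains only, where the Lyapunov equation is solvable.
  have hex : ∀ K : {K : Matrix (Fin m) (Fin n) ℝ // IsHurwitz (A - B * K)},
      ∃ P : Matrix (Fin n) (Fin n) ℝ, P.PosSemidef ∧ SolvesALE A B Q R K P :=
    fun K => K.2.exists_solvesALE hQ hR
  choose F hF using hex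
  let step : {K : Matrix (Fin m) (Fin n) ℝ // IsHurwitz (A - B * K)} →
      {K : Matrix (Fin m) (Fin n) ℝ // IsHurwitz (A - B * K)} := fun K =>
    ⟨R⁻¹ * Bᵀ * F K, K.2.improved_gain hQ hR (hF K).1 (hF K).2⟩
  refine ⟨fun i => F (step^[i] ⟨K₀, hK₀⟩), fun i => (step^[i] ⟨K₀, hK₀⟩).1, rfl,
    fun i => ⟨hF _, ?_⟩⟩
  simp only [Function.iterate_succ_apply']
  rfl

theorem IsKleinmanSeq.isHurwitz (hQ : Q.PosSemidef) (hR : R.PosDef)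
    {K₀ : Matrix (Fin m) (Fin n) ℝ} (hK₀ : IsHurwitz (A - B * K₀))
    {P : ℕ → Matrix (Fin n) (Fin n) ℝ} {K : ℕ → Matrix (Fin m) (Fin n) ℝ}
    (h : IsKleinmanSeq A B Q R K₀ P K) (i : ℕ) : IsHurwitz (A - B * K i) := by
  induction i with
  | zero => rwa [h.1]
  | succ i ih =>
    rw [(h.2 i).2]
    exact ih.improved_gain hQ hR (h.2 i).1.1 (h.2 i).1.2

theorem IsKleinmanSeq.sub_posSemidef (hQ : Q.PosSemidef) (hR : R.PosDef)
    {K₀ : Matrix (Fin m) (Fin n) ℝ} (hK₀ : IsHurwitz (A - B * K₀))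
    {P : ℕ → Matrix (Fin n) (Fin n) ℝ} {K : ℕ → Matrix (Fin m) (Fin n) ℝ}
    (h : IsKleinmanSeq A B Q R K₀ P K) (i : ℕ) : (P i - P (i + 1)).PosSemidef :=
  (h.2 i).1.2.sub_improved_posSemidef hR (h.2 i).1.1 (h.2 i).2 (h.2 (i + 1)).1.2
    (h.isHurwitz hQ hR hK₀ (i + 1))

/-- Passing to the limit in the Lyapunov equations gives the one for `X` and its own gain, which is
the Riccati equation. Detectability plays no role here. -/
theorem IsKleinmanSeq.exists_tendsto (hQ : Q.PosSemidef) (hR : R.PosDef)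
    {K₀ : Matrix (Fin m) (Fin n) ℝ} (hK₀ : IsHurwitz (A - B * K₀))
    {P : ℕ → Matrix (Fin n) (Fin n) ℝ} {K : ℕ → Matrix (Fin m) (Fin n) ℝ}
    (h : IsKleinmanSeq A B Q R K₀ P K) :
    ∃ X : Matrix (Fin n) (Fin n) ℝ, X.PosSemidef ∧ SolvesCARE A B Q R X ∧
      Filter.Tendsto K Filter.atTop (𝓝 (R⁻¹ * Bᵀ * X)) ∧ Filter.Tendsto P Filter.atTop (𝓝 X) := by
  obtain ⟨X, hX⟩ := exists_tendsto_of_antitone (fun i => (h.2 i).1.1)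
    (h.sub_posSemidef hQ hR hK₀)
  have hXp : X.PosSemidef :=
    isClosed_posSemidef.mem_of_tendsto hX (Filter.Eventually.of_forall fun i => (h.2 i).1.1)
  have hK : Filter.Tendsto K Filter.atTop (𝓝 (R⁻¹ * Bᵀ * X)) := by
    rw [← Filter.tendsto_add_atTop_iff_nat 1]
    simp only [(h.2 _).2]
    have hc : Continuous fun Y : Matrix (Fin n) (Fin n) ℝ => R⁻¹ * Bᵀ * Y := by fun_prop
    exact (hc.tendsto X).comp hX
  refine ⟨X, hXp, (solvesCARE_iff_solvesALE hR (posSemidef_isSymm hXp)).2 ?_, hK, hX⟩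
  have hc : Continuous fun Y : Matrix (Fin m) (Fin n) ℝ × Matrix (Fin n) (Fin n) ℝ =>
      (A - B * Y.1)ᵀ * Y.2 + Y.2 * (A - B * Y.1) + Y.1ᵀ * R * Y.1 + Q := by fun_prop
  have h1 := (hc.tendsto (R⁻¹ * Bᵀ * X, X)).comp (hK.prodMk_nhds hX)
  refine tendsto_nhds_unique h1 (tendsto_const_nhds.congr fun i => ?_)
  exact ((h.2 i).1.2 : _ = _).symm

/-- If every step of an iteration has exactly one solution along the sequences `P`, `K`, these are
the only sequences produced by the iteration. -/
theorem iteration_unique {α β : Type*} {s : β → α → Prop} {f : α → β} {P : ℕ → α} {K : ℕ → β}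
    {K₀ : β} (h0 : K 0 = K₀) (hK : ∀ i, K (i + 1) = f (P i))
    (hs : ∀ i p, s (K i) p ↔ p = P i) (P' : ℕ → α) (K' : ℕ → β) :
    (K' 0 = K₀ ∧ ∀ i, s (K' i) (P' i) ∧ K' (i + 1) = f (P' i)) ↔ P' = P ∧ K' = K := by
  constructor
  · rintro ⟨h0', h'⟩
    have hKK : ∀ i, K' i = K i := by
      intro i
      induction i with
      | zero => rw [h0, h0']
      | succ i ih => rw [hK, (h' i).2, (hs i (P' i)).1 (ih ▸ (h' i).1)]
    exact ⟨funext fun i => (hs i _).1 (hKK i ▸ (h' i).1), funext hKK⟩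
  · rintro ⟨rfl, rfl⟩
    exact ⟨h0, fun i => ⟨(hs i _).2 rfl, hK i⟩⟩

end PolicyIteration

open MeasureTheory

/-! ### The operators `v` and `𝓑` -/

/-- The factor `2` in `vec` cancels the `1 / 2` in `Wmat` off the diagonal. Both the pairing of
`bil` with `vec` and the injectivity of `vec` on symmetric matrices rest on this. -/
theorem Wmat_transpose_mulVec_vec {n : ℕ} {P : Matrix (Fin n) (Fin n) ℝ} (hP : Pᵀ = P) :
    (Wmat n)ᵀ *ᵥ vec P = fun p => P p.1 p.2 := by
  have hs : ∀ a b, P a b = P b a := fun a b => congrFun (congrFun hP b) a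
  funext p
  obtain ⟨a, b⟩ := p
  simp only [Matrix.mulVec, dotProduct, Matrix.transpose_apply, Wmat]
  rcases le_total a b with hab | hab
  · rw [Finset.sum_eq_single (⟨(a, b), hab⟩ : UpperIdx n)]
    · by_cases h : a = b
      · subst h; simp [vec]
      · simp [vec, h]
    · rintro ⟨⟨c, d⟩, hcd⟩ - hne
      have h1 : ¬ ((a, b) = (c, d)) := fun h => hne (by simp [← h])
      have h2 : ¬ ((a, b) = (c, d).swap) := by
        intro h
        simp only [Prod.swap, Prod.mk.injEq] at h hcd
        apply h1
        simp only [Prod.mk.injEq]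
        constructor <;> omega
      rw [if_neg h1, if_neg h2]
      simp
    · simp
  · rw [Finset.sum_eq_single (⟨(b, a), hab⟩ : UpperIdx n)]
    · by_cases h : a = b
      · subst h; simp [vec]
      · simp [vec, h, Ne.symm h, hs a b]
    · rintro ⟨⟨c, d⟩, hcd⟩ - hne
      have h2 : ¬ ((a, b) = (c, d).swap) := by
        intro h
        apply hne
        simp only [Prod.swap, Prod.mk.injEq] at h
        simp [h.1, h.2]
      have h1 : ¬ ((a, b) = (c, d)) := by
        intro h
        apply h2
        simp only [Prod.swap, Prod.mk.injEq] at h hcd ⊢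
        constructor <;> omega
      rw [if_neg h1, if_neg h2]
      simp
    · simp

theorem bil_dotProduct_vec {n : ℕ} {P : Matrix (Fin n) (Fin n) ℝ} (hP : Pᵀ = P)
    (x y : Fin n → ℝ) : bil x y ⬝ᵥ vec P = x ⬝ᵥ P *ᵥ y := by
  rw [← Wmat_mulVec_kronVec, dotProduct_comm, Matrix.dotProduct_mulVec, ← Matrix.mulVec_transpose,
    Wmat_transpose_mulVec_vec hP]
  simp only [dotProduct, kronVec, Matrix.mulVec, Fintype.sum_prod_type, Finset.mul_sum]
  exact Finset.sum_congr rfl fun a _ => Finset.sum_congr rfl fun b _ => by ring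

theorem vec_injective {n : ℕ} {P P' : Matrix (Fin n) (Fin n) ℝ} (hP : Pᵀ = P) (hP' : P'ᵀ = P')
    (h : vec P = vec P') : P = P' := by
  have h1 := Wmat_transpose_mulVec_vec hP
  rw [h, Wmat_transpose_mulVec_vec hP'] at h1
  ext a b
  exact (congrFun h1 (a, b)).symm

theorem vec_neg {n : ℕ} (P : Matrix (Fin n) (Fin n) ℝ) : vec (-P) = -vec P := by
  funext e
  simp only [vec, Matrix.neg_apply, Pi.neg_apply]
  split_ifs <;> ring

/-- `WrInv` restores `x ⊗ x`, the Kronecker factor acts on the second slot only, and `Wmat` returns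
to `bil`. -/
theorem Wij_mulVec_bil {N : ℕ} {n m : Fin N → ℕ} (sys : PartitionedSystem n m) (j : Fin N)
    (K : Matrix (Fin (m j)) (Fin (n j)) ℝ) (x : Fin (n j) → ℝ) :
    sys.Wij j K *ᵥ bil x x = bil x ((sys.Bjj j * K) *ᵥ x) := by
  rw [PartitionedSystem.Wij, ← Matrix.mulVec_mulVec, WrInv_mulVec_bil, ← Matrix.mulVec_mulVec,
    ← Wmat_mulVec_kronVec]
  congr 1
  funext p
  obtain ⟨a, b⟩ := p
  simp only [Matrix.mulVec, dotProduct, kronVec, Matrix.kronecker, Matrix.kroneckerMap_apply,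
    Fintype.sum_prod_type, Matrix.one_apply, ite_mul, one_mul, zero_mul]
  rw [Finset.sum_eq_single a]
  · simp only [if_true, Finset.mul_sum]
    exact Finset.sum_congr rfl fun c _ => by ring
  · intro c _ hc
    simp [Ne.symm hc]
  · simp

/-! ### Integrals along trajectories -/

/-- Carathéodory solutions are differentiable only almost everywhere, so the product rule is
integrated for absolutely continuous functions. -/
theorem integral_mul_add_mul_of_primitive {y z p q : ℝ → ℝ} {a b : ℝ} (hab : a ≤ b)
    (hp : IntervalIntegrable p volume a b) (hq : IntervalIntegrable q volume a b)
    (hy : ∀ s ∈ Set.Icc a b, y s = y a + ∫ τ in a..s, p τ)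
    (hz : ∀ s ∈ Set.Icc a b, z s = z a + ∫ τ in a..s, q τ) :
    ∫ τ in a..b, (p τ * z τ + y τ * q τ) = y b * z b - y a * z a := by
  have hac : ∀ {r : ℝ → ℝ} (c : ℝ), IntervalIntegrable r volume a b →
      AbsolutelyContinuousOnInterval (fun s => c + ∫ τ in a..s, r τ) a b := by
    intro r c hr
    have h1 : AbsolutelyContinuousOnInterval (fun _ : ℝ => c) a b :=
      ((LipschitzWith.const c).lipschitzOnWith).absolutelyContinuousOnInterval
    exact h1.add (hr.absolutelyContinuousOnInterval_intervalIntegral (by simp))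
  have key := (hac (y a) hp).integral_deriv_mul_eq_sub (hac (z a) hq)
  have ha : a ∈ Set.Icc a b := Set.left_mem_Icc.2 hab
  have hb : b ∈ Set.Icc a b := Set.right_mem_Icc.2 hab
  simp only [← hy _ ha, ← hz _ ha, ← hy _ hb, ← hz _ hb] at key
  rw [← key]
  refine intervalIntegral.integral_congr_ae ?_
  filter_upwards [hp.ae_hasDerivAt_integral, hq.ae_hasDerivAt_integral] with s h1 h2 h3
  have h4 : s ∈ Set.uIcc a b := Set.uIoc_subset_uIcc h3
  have h5 : s ∈ Set.Icc a b := by rwa [Set.uIcc_of_le hab] at h4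
  rw [((h1 h4 a (by simp)).const_add (y a)).deriv, ((h2 h4 a (by simp)).const_add (z a)).deriv,
    ← hy s h5, ← hz s h5]

theorem integral_quadratic_of_primitive {n : ℕ} {P : Matrix (Fin n) (Fin n) ℝ} (hP : Pᵀ = P)
    {y p : ℝ → Fin n → ℝ} {a b : ℝ} (hab : a ≤ b)
    (hp : ∀ i, IntervalIntegrable (fun τ => p τ i) volume a b)
    (hy : ∀ s ∈ Set.Icc a b, ∀ i, y s i = y a i + ∫ τ in a..s, p τ i)
    (hc : ∀ i, ContinuousOn (fun τ => y τ i) (Set.uIcc a b)) :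
    ∫ τ in a..b, 2 * (y τ ⬝ᵥ P *ᵥ p τ) = y b ⬝ᵥ P *ᵥ y b - y a ⬝ᵥ P *ᵥ y a := by
  have h1 : ∀ τ, 2 * (y τ ⬝ᵥ P *ᵥ p τ) =
      ∑ i, ∑ k, P i k * (p τ i * y τ k + y τ i * p τ k) := by
    intro τ
    have h : y τ ⬝ᵥ P *ᵥ p τ = p τ ⬝ᵥ P *ᵥ y τ := by
      rw [Matrix.dotProduct_mulVec, ← Matrix.mulVec_transpose, hP, dotProduct_comm]
    rw [two_mul]
    nth_rw 1 [h]
    simp only [dotProduct, Matrix.mulVec, Finset.mul_sum, ← Finset.sum_add_distrib]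
    exact Finset.sum_congr rfl fun a _ => Finset.sum_congr rfl fun b _ => by ring
  have hint : ∀ i k, IntervalIntegrable (fun τ => P i k * (p τ i * y τ k + y τ i * p τ k))
      volume a b := fun i k =>
    (((hp i).mul_continuousOn (hc k)).add ((hp k).continuousOn_mul (hc i))).const_mul _
  have hint' : ∀ i, IntervalIntegrable
      (fun τ => ∑ k, P i k * (p τ i * y τ k + y τ i * p τ k)) volume a b := by
    intro i
    have h := IntervalIntegrable.sum Finset.univ fun k _ => hint i k
    simpa only [Finset.sum_fn] using h
  simp only [h1]
  rw [intervalIntegral.integral_finsetSum fun i _ => hint' i]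
  have h2 : ∀ i, ∫ τ in a..b, ∑ k, P i k * (p τ i * y τ k + y τ i * p τ k) =
      ∑ k, P i k * (y b i * y b k - y a i * y a k) := by
    intro i
    rw [intervalIntegral.integral_finsetSum fun k _ => hint i k]
    refine Finset.sum_congr rfl fun k _ => ?_
    rw [intervalIntegral.integral_const_mul, integral_mul_add_mul_of_primitive hab (hp i) (hp k)
      (fun s hs => hy s hs i) (fun s hs => hy s hs k)]
  simp only [h2, dotProduct, Matrix.mulVec, Finset.mul_sum, ← Finset.sum_sub_distrib]
  exact Finset.sum_congr rfl fun a _ => Finset.sum_congr rfl fun b _ => by ring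

theorem intMat_mulVec {n l : ℕ} {t : Fin (l + 1) → ℝ} {y z : ℝ → Fin n → ℝ} {k : Fin l}
    (h : ∀ e, IntervalIntegrable (fun τ => bil (y τ) (z τ) e) volume (t k.castSucc) (t k.succ))
    (c : UpperIdx n → ℝ) :
    (intMat t y z *ᵥ c) k = ∫ τ in (t k.castSucc)..(t k.succ), bil (y τ) (z τ) ⬝ᵥ c := by
  simp only [dotProduct]
  rw [intervalIntegral.integral_finsetSum fun e _ => (h e).mul_const _]
  simp only [intervalIntegral.integral_mul_const]
  rfl

theorem intervalIntegrable_bil {n : ℕ} {y z : ℝ → Fin n → ℝ} {a b : ℝ}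
    (hy : ∀ i, ContinuousOn (fun τ => y τ i) (Set.uIcc a b))
    (hz : ∀ i, IntervalIntegrable (fun τ => z τ i) volume a b) (e : UpperIdx n) :
    IntervalIntegrable (fun τ => bil (y τ) (z τ) e) volume a b :=
  (((hz _).continuousOn_mul (hy _)).add ((hz _).continuousOn_mul (hy _))).div_const 2

theorem dotProduct_lyapunov {k : ℕ} {P M : Matrix (Fin k) (Fin k) ℝ} (hP : Pᵀ = P)
    (y : Fin k → ℝ) : y ⬝ᵥ (Mᵀ * P + P * M) *ᵥ y = 2 * (y ⬝ᵥ P *ᵥ (M *ᵥ y)) := by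
  have h : y ⬝ᵥ (Mᵀ * P) *ᵥ y = y ⬝ᵥ P *ᵥ (M *ᵥ y) := by
    rw [← Matrix.mulVec_mulVec, Matrix.dotProduct_mulVec, ← Matrix.mulVec_transpose,
      Matrix.transpose_transpose, dotProduct_comm, Matrix.dotProduct_mulVec y P,
      ← Matrix.mulVec_transpose, hP]
  rw [Matrix.add_mulVec, dotProduct_add, h, ← Matrix.mulVec_mulVec]
  ring

theorem intervalIntegrable_dotProduct_mulVec {n : ℕ} (P : Matrix (Fin n) (Fin n) ℝ)
    {y z : ℝ → Fin n → ℝ} {a b : ℝ} (hy : ∀ i, ContinuousOn (fun τ => y τ i) (Set.uIcc a b))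
    (hz : ∀ i, IntervalIntegrable (fun τ => z τ i) volume a b) :
    IntervalIntegrable (fun τ => y τ ⬝ᵥ P *ᵥ z τ) volume a b := by
  simp only [dotProduct, Matrix.mulVec]
  have h1 : ∀ i, IntervalIntegrable (fun τ => ∑ k, P i k * z τ k) volume a b := by
    intro i
    have h := IntervalIntegrable.sum Finset.univ fun k _ => (hz k).const_mul (P i k)
    simpa only [Finset.sum_fn] using h
  have h := IntervalIntegrable.sum Finset.univ fun i _ => (h1 i).continuousOn_mul (hy i)
  simpa only [Finset.sum_fn] using h

theorem continuousOn_mulVec {n m : ℕ} (G : Matrix (Fin m) (Fin n) ℝ) {y : ℝ → Fin n → ℝ}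
    {s : Set ℝ} (hy : ∀ i, ContinuousOn (fun τ => y τ i) s) (i : Fin m) :
    ContinuousOn (fun τ => (G *ᵥ y τ) i) s := by
  simp only [dotProduct, Matrix.mulVec]
  exact continuousOn_finsetSum _ fun k _ => (hy k).const_mul _

theorem intervalIntegrable_of_memLp_two {n : ℕ} {z : ℝ → Fin n → ℝ} {a b c d : ℝ}
    (hz : MemLp z 2 (volume.restrict (Set.Icc a b))) (hcd : c ≤ d)
    (h : Set.Icc c d ⊆ Set.Icc a b) (i : Fin n) :
    IntervalIntegrable (fun τ => z τ i) volume c d := by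
  rw [intervalIntegrable_iff_integrableOn_Icc_of_le hcd]
  have h1 : IntegrableOn (fun τ => z τ i) (Set.Icc a b) :=
    (hz.integrable (by norm_num)).eval i
  exact h1.mono_set h

/-! ### Solutions of the system and the regression matrix along them -/

namespace PartitionedSystem

variable {N : ℕ} {n m : Fin N → ℕ} {sys : PartitionedSystem n m}

theorem IsSolutionOn.intervalIntegrable {u : ℝ → BlockIdx m → ℝ} {x : ℝ → BlockIdx n → ℝ}
    {a b c d : ℝ} (hx : sys.IsSolutionOn u x a b) (hcd : c ≤ d)
    (h : Set.Icc c d ⊆ Set.Icc a b) (q : BlockIdx n) :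
    IntervalIntegrable (fun τ => (sys.f (x τ) + sys.g (x τ) *ᵥ u τ) q) volume c d := by
  rw [intervalIntegrable_iff_integrableOn_Icc_of_le hcd]
  have h1 : IntegrableOn (fun τ => (sys.f (x τ) + sys.g (x τ) *ᵥ u τ) q) (Set.Icc a b) :=
    Integrable.eval hx.1 q
  exact h1.mono_set h

theorem IsSolutionOn.eq_add_integral {u : ℝ → BlockIdx m → ℝ} {x : ℝ → BlockIdx n → ℝ}
    {a b c d : ℝ} (hx : sys.IsSolutionOn u x a b) (hcd : c ≤ d)
    (h : Set.Icc c d ⊆ Set.Icc a b) (q : BlockIdx n) :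
    ∀ s ∈ Set.Icc c d, x s q = x c q + ∫ τ in c..s, (sys.f (x τ) + sys.g (x τ) *ᵥ u τ) q := by
  have h0 : ∀ s ∈ Set.Icc a b,
      x s q = x a q + ∫ τ in a..s, (sys.f (x τ) + sys.g (x τ) *ᵥ u τ) q := by
    intro s hs
    have hI : IntervalIntegrable (fun τ => sys.f (x τ) + sys.g (x τ) *ᵥ u τ) volume a s := by
      rw [intervalIntegrable_iff_integrableOn_Icc_of_le hs.1]
      exact hx.1.mono_set (Set.Icc_subset_Icc_right hs.2)
    have h1 := ContinuousLinearMap.intervalIntegral_comp_comm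
      (ContinuousLinearMap.proj (R := ℝ) (φ := fun _ : BlockIdx n => ℝ) q) hI
    simp only [ContinuousLinearMap.proj_apply] at h1
    conv_lhs => rw [hx.2 s hs]
    rw [Pi.add_apply, h1]
  intro s hs
  have hc := h (Set.left_mem_Icc.2 hcd)
  have hs' := h hs
  have h2 := intervalIntegral.integral_add_adjacent_intervals
    (hx.intervalIntegrable hc.1 (Set.Icc_subset_Icc_right hc.2) q)
    (hx.intervalIntegrable hs.1 ((Set.Icc_subset_Icc_right hs.2).trans h) q)
  rw [h0 s hs', h0 c hc, ← h2]
  ring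

theorem IsSolutionOn.continuousOn {u : ℝ → BlockIdx m → ℝ} {x : ℝ → BlockIdx n → ℝ}
    {a b c d : ℝ} (hx : sys.IsSolutionOn u x a b) (hcd : c ≤ d)
    (h : Set.Icc c d ⊆ Set.Icc a b) (q : BlockIdx n) :
    ContinuousOn (fun τ => x τ q) (Set.uIcc c d) := by
  have h1 := (hx.intervalIntegrable hcd h q).absolutelyContinuousOnInterval_intervalIntegral
    (c := c) (by simp)
  refine (h1.continuousOn.const_add (x c q)).congr fun s hs => ?_
  rw [Set.uIcc_of_le hcd] at hs
  exact hx.eq_add_integral hcd h q s hs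

theorem block_eq_drift_add_input (sys : PartitionedSystem n m) (j : Fin N)
    (u : ℝ → BlockIdx m → ℝ) (x : ℝ → BlockIdx n → ℝ) (τ : ℝ) :
    block j (sys.f (x τ) + sys.g (x τ) *ᵥ u τ) =
      sys.Ajj j *ᵥ block j (x τ) + sys.inputSignal j u x τ + sys.driftSignal j x τ := by
  have h : block j (sys.f (x τ) + sys.g (x τ) *ᵥ u τ) =
      block j (sys.f (x τ)) + block j (sys.g (x τ) *ᵥ u τ) := rfl
  rw [h, inputSignal, driftSignal]
  abel

/-- Along trajectories the regression matrix factors through the Lyapunov operator of the closed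
loop. -/
theorem Theta_mulVec_vec (sys : PartitionedSystem n m) (j : Fin N) {l : ℕ}
    {t : Fin (l + 1) → ℝ} (ht : StrictMono t) {u : ℝ → BlockIdx m → ℝ}
    {x : ℝ → BlockIdx n → ℝ} (hx : sys.IsSolutionOn u x (t 0) (t (Fin.last l)))
    (hu : MemLp (sys.inputSignal j u x) 2
      (volume.restrict (Set.Icc (t 0) (t (Fin.last l)))))
    (hw : MemLp (sys.driftSignal j x) 2
      (volume.restrict (Set.Icc (t 0) (t (Fin.last l)))))
    (K : Matrix (Fin (m j)) (Fin (n j)) ℝ) {P : Matrix (Fin (n j)) (Fin (n j)) ℝ}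
    (hP : Pᵀ = P) :
    sys.Theta j t u x K *ᵥ vec P =
      intMat t (fun τ => block j (x τ)) (fun τ => block j (x τ)) *ᵥ
        vec ((sys.Ajj j - sys.Bjj j * K)ᵀ * P + P * (sys.Ajj j - sys.Bjj j * K)) := by
  set M := sys.Ajj j - sys.Bjj j * K with hM
  have hMP : (Mᵀ * P + P * M)ᵀ = Mᵀ * P + P * M := by
    rw [Matrix.transpose_add, Matrix.transpose_mul, Matrix.transpose_mul,
      Matrix.transpose_transpose, hP, add_comm]
  funext k
  have hab : t k.castSucc ≤ t k.succ := (ht Fin.castSucc_lt_succ).le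
  have hsub : Set.Icc (t k.castSucc) (t k.succ) ⊆ Set.Icc (t 0) (t (Fin.last l)) :=
    Set.Icc_subset_Icc (ht.monotone (Fin.zero_le _)) (ht.monotone (Fin.le_last _))
  have hc : ∀ i, ContinuousOn (fun τ => block j (x τ) i) (Set.uIcc (t k.castSucc) (t k.succ)) :=
    fun i => hx.continuousOn hab hsub ⟨j, i⟩
  have hu' := intervalIntegrable_of_memLp_two hu hab hsub
  have hw' := intervalIntegrable_of_memLp_two hw hab hsub
  have hq := integral_quadratic_of_primitive hP hab (y := fun τ => block j (x τ))
    (p := fun τ => block j (sys.f (x τ) + sys.g (x τ) *ᵥ u τ))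
    (fun i => hx.intervalIntegrable hab hsub ⟨j, i⟩)
    (fun s hs i => hx.eq_add_integral hab hsub ⟨j, i⟩ s hs) hc
  have hxI : ∀ i, IntervalIntegrable (fun τ => block j (x τ) i) volume (t k.castSucc)
    (t k.succ) := fun i => (hc i).intervalIntegrable
  have hBKI : ∀ i, IntervalIntegrable (fun τ => ((sys.Bjj j * K) *ᵥ block j (x τ)) i) volume
    (t k.castSucc) (t k.succ) := fun i => (continuousOn_mulVec _ hc i).intervalIntegrable
  -- By symmetry of `P` the cross terms of `(y + z)ᵀ P (y - z)` cancel, leaving the increment of the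
  -- quadratic form.
  have hδ : deltaMat t (fun τ => block j (x τ)) (fun τ => block j (x τ)) k ⬝ᵥ vec P =
      block j (x (t k.succ)) ⬝ᵥ P *ᵥ block j (x (t k.succ)) -
        block j (x (t k.castSucc)) ⬝ᵥ P *ᵥ block j (x (t k.castSucc)) := by
    rw [deltaMat, bil_dotProduct_vec hP]
    generalize block j (x (t k.succ)) = y
    generalize block j (x (t k.castSucc)) = z
    have h : z ⬝ᵥ P *ᵥ y = y ⬝ᵥ P *ᵥ z := by
      rw [Matrix.dotProduct_mulVec, ← Matrix.mulVec_transpose, hP, dotProduct_comm]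
    simp only [Matrix.mulVec_sub, dotProduct_sub, add_dotProduct, h]
    ring
  have hW : ∀ τ, bil (block j (x τ)) (block j (x τ)) ⬝ᵥ ((sys.Wij j K)ᵀ *ᵥ vec P) =
      block j (x τ) ⬝ᵥ P *ᵥ ((sys.Bjj j * K) *ᵥ block j (x τ)) := by
    intro τ
    rw [Matrix.mulVec_transpose, dotProduct_comm, ← Matrix.dotProduct_mulVec, dotProduct_comm,
      Wij_mulVec_bil, bil_dotProduct_vec hP]
  -- Writing `A_jj = M + B_jj K` splits the derivative of `x_jᵀ P x_j` into the Lyapunov term and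
  -- the three terms that `Theta` subtracts.
  have hpt : ∀ τ, 2 * (block j (x τ) ⬝ᵥ P *ᵥ block j (sys.f (x τ) + sys.g (x τ) *ᵥ u τ)) =
      block j (x τ) ⬝ᵥ (Mᵀ * P + P * M) *ᵥ block j (x τ) +
      2 * (block j (x τ) ⬝ᵥ P *ᵥ ((sys.Bjj j * K) *ᵥ block j (x τ)) +
        block j (x τ) ⬝ᵥ P *ᵥ sys.inputSignal j u x τ +
        block j (x τ) ⬝ᵥ P *ᵥ sys.driftSignal j x τ) := by
    intro τ
    rw [dotProduct_lyapunov hP, block_eq_drift_add_input, hM]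
    simp only [Matrix.sub_mulVec, Matrix.mulVec_add, Matrix.mulVec_sub, dotProduct_add,
      dotProduct_sub]
    ring
  have i0 := intervalIntegrable_dotProduct_mulVec (Mᵀ * P + P * M) hc hxI
  have i1 := intervalIntegrable_dotProduct_mulVec P hc hBKI
  have i2 := intervalIntegrable_dotProduct_mulVec P hc hu'
  have i3 := intervalIntegrable_dotProduct_mulVec P hc hw'
  simp only [hpt] at hq
  rw [intervalIntegral.integral_add i0 (((i1.add i2).add i3).const_mul 2),
    intervalIntegral.integral_const_mul, intervalIntegral.integral_add (i1.add i2) i3,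
    intervalIntegral.integral_add i1 i2] at hq
  rw [Theta, Matrix.sub_mulVec, Matrix.smul_mulVec, Matrix.add_mulVec, Matrix.add_mulVec,
    ← Matrix.mulVec_mulVec, Pi.sub_apply, Pi.smul_apply, Pi.add_apply, Pi.add_apply,
    intMat_mulVec (intervalIntegrable_bil hc hxI), intMat_mulVec (intervalIntegrable_bil hc hxI),
    intMat_mulVec (intervalIntegrable_bil hc hu'), intMat_mulVec (intervalIntegrable_bil hc hw')]
  simp only [hW, bil_dotProduct_vec hP, bil_dotProduct_vec hMP, smul_eq_mul]
  rw [Matrix.mulVec, hδ, ← hq]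
  ring

end PartitionedSystem

/-! ### Least squares and the equivalence with the Lyapunov equation -/

theorem FullColumnRank.mulVec_injective {r c : Type*} [Fintype r] [Fintype c] {M : Matrix r c ℝ}
    (h : FullColumnRank M) : Function.Injective M.mulVec := by
  have h1 := LinearMap.finrank_range_add_finrank_ker M.mulVecLin
  have h2 : Module.finrank ℝ (LinearMap.range M.mulVecLin) = Fintype.card c := h
  rw [h2, Module.finrank_fintype_fun_eq_card] at h1
  have h3 : LinearMap.ker M.mulVecLin = ⊥ := Submodule.finrank_eq_zero.1 (by omega)
  exact LinearMap.ker_eq_bot.1 h3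

theorem IsLeastSquares.eq_of_consistent {r c : Type*} [Fintype r] [Fintype c] {Θ : Matrix r c ℝ}
    {Ξ : r → ℝ} {θ η : c → ℝ} (hθ : IsLeastSquares Θ Ξ θ) (hη : Θ *ᵥ η = Ξ) : Θ *ᵥ θ = Ξ := by
  have h1 := hθ η
  rw [hη, sub_self] at h1
  have h2 : ∑ k, ((Θ *ᵥ θ - Ξ) k) ^ 2 = 0 :=
    le_antisymm (by simpa using h1) (Finset.sum_nonneg fun _ _ => sq_nonneg _)
  rw [Finset.sum_eq_zero_iff_of_nonneg fun _ _ => sq_nonneg _] at h2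
  refine sub_eq_zero.1 (funext fun k => ?_)
  exact pow_eq_zero_iff two_ne_zero |>.1 (h2 k (Finset.mem_univ k))

theorem isLeastSquares_of_eq {r c : Type*} [Fintype r] [Fintype c] {Θ : Matrix r c ℝ}
    {Ξ : r → ℝ} {θ : c → ℝ} (hθ : Θ *ᵥ θ = Ξ) : IsLeastSquares Θ Ξ θ := by
  intro η
  rw [hθ, sub_self]
  simpa using Finset.sum_nonneg fun k _ => sq_nonneg ((Θ *ᵥ η - Ξ) k)

/-- The regression is solved at equality exactly by the solutions of the Lyapunov equation. -/
theorem Theta_mulVec_vec_eq_Xi_iff {N : ℕ} {n m : Fin N → ℕ} (sys : PartitionedSystem n m)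
    (j : Fin N) {Q : Matrix (Fin (n j)) (Fin (n j)) ℝ} {R : Matrix (Fin (m j)) (Fin (m j)) ℝ}
    (hQ : Q.PosSemidef) (hR : R.PosDef) {l : ℕ}
    {t : Fin (l + 1) → ℝ} (ht : StrictMono t) {u : ℝ → BlockIdx m → ℝ}
    {x : ℝ → BlockIdx n → ℝ} (hx : sys.IsSolutionOn u x (t 0) (t (Fin.last l)))
    (hu : MemLp (sys.inputSignal j u x) 2
      (volume.restrict (Set.Icc (t 0) (t (Fin.last l)))))
    (hw : MemLp (sys.driftSignal j x) 2
      (volume.restrict (Set.Icc (t 0) (t (Fin.last l)))))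
    (hrank : FullColumnRank (intMat t (fun τ => block j (x τ)) (fun τ => block j (x τ))))
    (K : Matrix (Fin (m j)) (Fin (n j)) ℝ) {P : Matrix (Fin (n j)) (Fin (n j)) ℝ}
    (hP : Pᵀ = P) :
    sys.Theta j t u x K *ᵥ vec P = Xi t (fun τ => block j (x τ)) Q R K ↔
      SolvesALE (sys.Ajj j) (sys.Bjj j) Q R K P := by
  rw [sys.Theta_mulVec_vec j ht hx hu hw K hP, Xi, ← Matrix.mulVec_neg,
    hrank.mulVec_injective.eq_iff, ← vec_neg, SolvesALE, add_assoc, add_comm (Kᵀ * R * K) Q,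
    add_eq_zero_iff_eq_neg]
  -- Cancelling `vec` is legitimate because both sides of the Lyapunov equation are symmetric.
  refine ⟨fun h => vec_injective ?_ ?_ h, fun h => h ▸ rfl⟩
  · rw [Matrix.transpose_add, Matrix.transpose_mul, Matrix.transpose_mul,
      Matrix.transpose_transpose, hP, add_comm]
  · rw [Matrix.transpose_neg, posSemidef_isSymm (hQ.add (posSemidef_conj hR K))]

end DEIRL

theorem theorem3 {N : ℕ} {n m : Fin N → ℕ} (sys : DEIRL.PartitionedSystem n m) (j : Fin N)
    (Q : Matrix (Fin (n j)) (Fin (n j)) ℝ) (R : Matrix (Fin (m j)) (Fin (m j)) ℝ)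
    (hQ : Q.PosSemidef) (hR : R.PosDef)
    -- the experiment: initial controllers, exploration noise, state trajectory, sample instants
    (K₀ : ∀ k, Matrix (Fin (m k)) (Fin (n k)) ℝ) (d : ℝ → DEIRL.BlockIdx m → ℝ)
    (x : ℝ → DEIRL.BlockIdx n → ℝ) (l : ℕ) (t : Fin (l + 1) → ℝ) (ht : StrictMono t)
    (hx : sys.IsSolutionOn (DEIRL.control K₀ d x) x (t 0) (t (Fin.last l)))
    -- the signals of loop `j` entering the data matrices are square-integrable
    (hu : MeasureTheory.MemLp (sys.inputSignal j (DEIRL.control K₀ d x) x) 2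
      (MeasureTheory.volume.restrict (Set.Icc (t 0) (t (Fin.last l)))))
    (hw : MeasureTheory.MemLp (sys.driftSignal j x) 2
      (MeasureTheory.volume.restrict (Set.Icc (t 0) (t (Fin.last l)))))
    (hrank : DEIRL.FullColumnRank
      (DEIRL.intMat t (fun τ => DEIRL.block j (x τ)) (fun τ => DEIRL.block j (x τ))))
    (hK₀ : DEIRL.IsHurwitz (sys.Ajj j - sys.Bjj j * K₀ j)) :
    ∃ (P : ℕ → Matrix (Fin (n j)) (Fin (n j)) ℝ) (K : ℕ → Matrix (Fin (m j)) (Fin (n j)) ℝ),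
      -- both algorithms produce exactly the sequences `P`, `K`
      (∀ P' K', DEIRL.IsKleinmanSeq (sys.Ajj j) (sys.Bjj j) Q R (K₀ j) P' K' ↔
        P' = P ∧ K' = K) ∧
      (∀ P' K', DEIRL.IsDEIRLSeq sys j Q R (K₀ j) t (DEIRL.control K₀ d x) x P' K' ↔
        P' = P ∧ K' = K) ∧
      -- the regressions are solved at equality
      (∀ i, sys.Theta j t (DEIRL.control K₀ d x) x (K i) *ᵥ DEIRL.vec (P i) =
        DEIRL.Xi t (fun τ => DEIRL.block j (x τ)) Q R (K i)) ∧
      -- stability and monotonicity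
      (∀ i, DEIRL.IsHurwitz (sys.Ajj j - sys.Bjj j * K i)) ∧
      (∀ i, (P i - P (i + 1)).PosSemidef) ∧
      -- the lower bound and the convergence, for `(Q^{1/2}, A_jj)` detectable
      (∀ S, DEIRL.IsPSDSqrt Q S → DEIRL.IsDetectable S (sys.Ajj j) →
        ∃ Pstar : Matrix (Fin (n j)) (Fin (n j)) ℝ,
          (∀ X, (X.PosSemidef ∧ DEIRL.SolvesCARE (sys.Ajj j) (sys.Bjj j) Q R X) ↔ X = Pstar) ∧
          (∀ i, (P i - Pstar).PosSemidef) ∧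
          Filter.Tendsto K Filter.atTop (𝓝 (R⁻¹ * (sys.Bjj j)ᵀ * Pstar)) ∧
          Filter.Tendsto P Filter.atTop (𝓝 Pstar) ∧
          -- positive definiteness, for `(Q^{1/2}, A_jj)` observable
          (DEIRL.IsObservable S (sys.Ajj j) → Pstar.PosDef ∧ ∀ i, (P i).PosDef)) := by

  obtain ⟨P, K, hPK⟩ := DEIRL.exists_isKleinmanSeq hQ hR hK₀
  have hH := hPK.isHurwitz hQ hR hK₀
  have hΘ := fun i {X : Matrix (Fin (n j)) (Fin (n j)) ℝ} (hX : Xᵀ = X) =>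
    DEIRL.Theta_mulVec_vec_eq_Xi_iff sys j hQ hR ht hx hu hw hrank (K i) hX
  have hsol := fun i => (hΘ i (DEIRL.posSemidef_isSymm (hPK.2 i).1.1)).2 (hPK.2 i).1.2
  refine ⟨P, K, ?_, ?_, hsol, hH, hPK.sub_posSemidef hQ hR hK₀, ?_⟩
  · refine DEIRL.iteration_unique
      (s := fun K P => P.PosSemidef ∧ DEIRL.SolvesALE (sys.Ajj j) (sys.Bjj j) Q R K P)
      (f := fun P => R⁻¹ * (sys.Bjj j)ᵀ * P) hPK.1 (fun i => (hPK.2 i).2) fun i p => ?_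
    exact ⟨fun h => h.2.unique (hH i) (hPK.2 i).1.2, fun h => h ▸ (hPK.2 i).1⟩
  · refine DEIRL.iteration_unique
      (s := fun K P => P.IsSymm ∧ DEIRL.IsLeastSquares
        (sys.Theta j t (DEIRL.control K₀ d x) x K)
        (DEIRL.Xi t (fun τ => DEIRL.block j (x τ)) Q R K) (DEIRL.vec P))
      (f := fun P => R⁻¹ * (sys.Bjj j)ᵀ * P) hPK.1 (fun i => (hPK.2 i).2) fun i p => ?_
    constructor
    · rintro ⟨hs, hls⟩
      -- Kleinman's `P i` makes the residual zero, so every least-squares solution is exact and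
      -- solves the Lyapunov equation; positive semidefiniteness need not be imposed on the
      -- regression.
      exact ((hΘ i hs).1 (hls.eq_of_consistent (hsol i))).unique (hH i) (hPK.2 i).1.2
    · rintro rfl
      exact ⟨DEIRL.posSemidef_isSymm (hPK.2 i).1.1, DEIRL.isLeastSquares_of_eq (hsol i)⟩
  · intro S hS hD
    obtain ⟨X, hX, hC, hK, hP⟩ := hPK.exists_tendsto hQ hR hK₀
    have hle := fun i => hC.sub_posSemidef hR hX (hPK.2 i).1.2 (hH i)
    refine ⟨X, fun Y => ⟨fun hY => hY.2.unique hQ hR hS hD hY.1 hX hC, ?_⟩, hle, hK, hP,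
      fun hO => ?_⟩
    · rintro rfl
      exact ⟨hX, hC⟩
    · have hXd := hC.posDef hQ hS hO hX
      -- `P i` is the positive definite `X` plus the positive semidefinite `P i - X`.
      exact ⟨hXd, fun i => by simpa using hXd.add_posSemidef (hle i)⟩
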